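/- Let $[n]=\{1,2,\dots,n\}$. Let $F_{4,3}(n)$ be the maximal size of a set $A\subseteq[n]$ such that the equation $a_1a_2a_3a_4=x^3$, $a_1<a_2<a_3<a_4$, has no solution with $a_1,a_2,a_3,a_4\in A$ and integer $x$. Let $f_{4,3}(n)$ be the maximal size of a set $A\subseteq[n]$ such that the equation $a_1a_2a_3a_4=x^3$ has no solution with (not necessarily distinct) $a_1,a_2,a_3,a_4\in A$ and integer $x$, except trivial solutions, i.e. those where the multiset of the $a_i$ can be partitioned into triples each consisting of three copies of the same number (since $3\nmid 4$, there are in fact no trivial solutions). Theorem. Let $\varepsilon>0$. There exists $n_0(\varepsilon)$ such that for every $n\ge n_0(\varepsilon)$, $$\frac{n}{(\log n)^{2+\varepsilon}}<n-F_{4,3}(n)\le n-f_{4,3}(n)<\frac{n}{(\log n)^{1-\frac{e\log 3}{2\sqrt3}-\varepsilon}}.$$ -/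

import Mathlib

/-- Property `P_{k,d}`: the equation `a₁ a₂ ⋯ a_k = x ^ d`, `a₁ < a₂ < ⋯ < a_k`, has no solution with
all `a_i` in `A` and `x` an integer. -/
def PropertyP (k d : ℕ) (A : Set ℕ) : Prop :=
  ¬ ∃ (a : Fin k → ℕ) (x : ℤ), (∀ i, a i ∈ A) ∧ StrictMono a ∧ ∏ i, (a i : ℤ) = x ^ d

/-- The tuple `a₁, …, a_k` is trivial: the multiset of the `a_i` can be partitioned into `d`-tuples,
each of which consists of `d` copies of the same number. -/
def IsTrivialTuple {k : ℕ} (d : ℕ) (a : Fin k → ℕ) : Prop :=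
  ∃ P : Multiset (Multiset ℕ),
    (∀ T ∈ P, ∃ b : ℕ, T = Multiset.replicate d b) ∧
      P.sum = (Finset.univ : Finset (Fin k)).val.map a

/-- Membership in the family `γ_{k,d}`: every solution of `a₁ a₂ ⋯ a_k = x ^ d` with all `a_i` in `A`
(not necessarily distinct) and `x` an integer is trivial. -/
def PropertyGamma (k d : ℕ) (A : Set ℕ) : Prop :=
  ∀ (a : Fin k → ℕ) (x : ℤ), (∀ i, a i ∈ A) → ∏ i, (a i : ℤ) = x ^ d → IsTrivialTuple d a

open Classical in
/-- `F_{k,d}(n)`: the maximal size of a set `A ⊆ {1, …, n}` with property `P_{k,d}`. -/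
noncomputable def maxSizeP (k d n : ℕ) : ℕ :=
  ((Finset.Icc 1 n).powerset.filter (fun A : Finset ℕ => PropertyP k d (A : Set ℕ))).sup Finset.card

open Classical in
/-- `f_{k,d}(n)`: the maximal size of a set `A ⊆ {1, …, n}` in the family `γ_{k,d}`. -/
noncomputable def maxSizeGamma (k d n : ℕ) : ℕ :=
  ((Finset.Icc 1 n).powerset.filter
    (fun A : Finset ℕ => PropertyGamma k d (A : Set ℕ))).sup Finset.card

open Finset ArithmeticFunction

/-! Both bounds come from one family of solutions: for any `b₀, …, b₃`, the four products `aᵢ = ∏_{j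
≠ i} bⱼ` multiply to `(∏ bⱼ)³`.

Lower bound. For distinct `bⱼ ≤ N ≈ n^(1/3)` some `aᵢ` must be missing from `A`. Give each quadruple
the weight `∏ 3^(-Ω(bⱼ))`. A missing number `a` has at most `3^Ω(a)` ordered factorizations into
three factors, so it absorbs weight at most 1. With `W = ∑_{m ≤ N} 3^(-Ω(m))` this gives `W⁴ ≤ 6W³ +
4W(n - #A)` (`omegaPow_sum_pow_le_card`), and `W³ ≫ N³/(log N)²` (`exists_le_sum_omegaPow_third`).

Upper bound. Conversely, if the `aᵢ` lie in `[n/T, n]` and have no large square divisor, every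
solution has this shape up to small factors, with all `bⱼ` equal to `n^(1/3)` up to powers of `T`
(`exists_balanced_factorization`). It suffices to delete the numbers with such a factorization,
besides those that are small, have a large square divisor, or have more than `Y` divisors. Weights
`2^(-Ω)` bound the balanced numbers by about `Y n (log n)^(-3/2)` up to powers of `log log n`; those
with many divisors number at most about `n log n / Y`. Taking `Y = (log n)^(5/4)` saves every power
of `log n` below `1/4`, which exceeds `1 - e log 3/(2√3) ≈ 0.138`. -/

theorem Nat.card_finMulAntidiag_le (k a : ℕ) (ha : a ≠ 0) :
    #(k.finMulAntidiag a) ≤ k ^ cardFactors a := by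
  induction a using induction_on_primes with
  | zero => exact absurd rfl ha
  | one => simp [Nat.finMulAntidiag_one]
  | prime_mul p a hp ih =>
    have ha0 : a ≠ 0 := right_ne_zero_of_mul ha
    -- The prime `p` divides some coordinate and can be divided out there, so each new prime
    -- multiplies the count by at most `k`.
    have hsub : k.finMulAntidiag (p * a) ⊆
        ((univ : Finset (Fin k)) ×ˢ k.finMulAntidiag a).image
          (fun q => Function.update q.2 q.1 (p * q.2 q.1)) := by
      intro f hf
      rw [Nat.mem_finMulAntidiag] at hf
      obtain ⟨i, -, hi⟩ := hp.prime.exists_mem_finset_dvd (s := univ) (f := f)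
        (by rw [hf.1]; exact dvd_mul_right _ _)
      obtain ⟨c, hc⟩ := hi
      simp only [mem_image, mem_product, mem_univ, true_and, Prod.exists]
      refine ⟨i, Function.update f i c, ?_, ?_⟩
      · rw [Nat.mem_finMulAntidiag]
        refine ⟨?_, ha0⟩
        have h1 := hf.1
        rw [← mul_prod_erase univ f (mem_univ i), hc, mul_assoc] at h1
        rw [prod_update_of_mem (mem_univ i), ← erase_eq]
        exact Nat.eq_of_mul_eq_mul_left hp.pos h1
      · ext j
        by_cases hj : j = i
        · subst hj; simp [hc]
        · simp [hj]
    calc #(k.finMulAntidiag (p * a))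
        ≤ #((univ : Finset (Fin k)) ×ˢ k.finMulAntidiag a) :=
          (card_le_card hsub).trans Finset.card_image_le
      _ = k * #(k.finMulAntidiag a) := by simp
      _ ≤ k * k ^ cardFactors a := Nat.mul_le_mul_left _ (ih ha0)
      _ = k ^ cardFactors (p * a) := by
          rw [cardFactors_mul hp.ne_zero ha0, cardFactors_apply_prime hp]; ring

/-! ### The weights `z ^ Ω(m)` and their logarithmic sums -/

/-- The completely multiplicative function `m ↦ z ^ Ω(m)`. -/
noncomputable def omegaPow (z : ℝ) : ArithmeticFunction ℝ :=
  ⟨fun n => if n = 0 then 0 else z ^ cardFactors n, by simp⟩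

theorem omegaPow_apply (z : ℝ) {n : ℕ} (hn : n ≠ 0) : omegaPow z n = z ^ cardFactors n :=
  if_neg hn

theorem omegaPow_one (z : ℝ) : omegaPow z 1 = 1 := by simp [omegaPow_apply]

theorem omegaPow_mul (z : ℝ) (m n : ℕ) : omegaPow z (m * n) = omegaPow z m * omegaPow z n := by
  by_cases hm : m = 0
  · simp [hm]
  by_cases hn : n = 0
  · simp [hn]
  rw [omegaPow_apply z hm, omegaPow_apply z hn, omegaPow_apply z (mul_ne_zero hm hn),
    cardFactors_mul hm hn, pow_add]

theorem omegaPow_prod (z : ℝ) {ι : Type*} (s : Finset ι) (f : ι → ℕ) :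
    omegaPow z (∏ i ∈ s, f i) = ∏ i ∈ s, omegaPow z (f i) := by
  classical
  induction s using Finset.induction_on with
  | empty => simp [omegaPow_one]
  | insert i s hi ih => rw [prod_insert hi, prod_insert hi, omegaPow_mul, ih]

theorem omegaPow_nonneg {z : ℝ} (hz : 0 ≤ z) (n : ℕ) : 0 ≤ omegaPow z n := by
  by_cases hn : n = 0
  · simp [hn]
  · rw [omegaPow_apply z hn]; positivity

theorem omegaPow_le_one {z : ℝ} (hz : 0 ≤ z) (hz1 : z ≤ 1) (n : ℕ) : omegaPow z n ≤ 1 := by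
  by_cases hn : n = 0
  · simp [hn]
  · rw [omegaPow_apply z hn]; exact pow_le_one₀ hz hz1

/-- A completely multiplicative factor distributes over Dirichlet convolution; this is `ζ * Λ = log`
twisted by the weight. -/
theorem omegaPow_pmul_log (z : ℝ) :
    pmul (omegaPow z) log = omegaPow z * pmul (omegaPow z) vonMangoldt := by
  ext n
  rw [← zeta_mul_vonMangoldt, pmul_apply, mul_apply, mul_apply, mul_sum]
  refine sum_congr rfl fun x hx => ?_
  rw [Nat.mem_divisorsAntidiagonal] at hx
  have h0 : x.1 ≠ 0 := by
    rintro h; apply hx.2; rw [← hx.1, h, zero_mul]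
  rw [← hx.1, omegaPow_mul, pmul_apply]
  simp [h0]
  ring

theorem sum_omegaPow_mul_log (z : ℝ) (N : ℕ) :
    ∑ m ∈ Ioc 0 N, omegaPow z m * Real.log m =
      ∑ k ∈ Ioc 0 N, omegaPow z k * ∑ d ∈ Ioc 0 (N / k), omegaPow z d * vonMangoldt d := by
  have h := sum_Ioc_mul_eq_sum_sum (omegaPow z) (pmul (omegaPow z) vonMangoldt) N
  rw [← omegaPow_pmul_log] at h
  simpa [pmul_apply] using h

/-- Expand the power and group by the product `a`: at most `k^Ω(a)` tuples, each contributing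
`k^(-Ω(a))/a`. -/
theorem pow_sum_omegaPow_div_le {k : ℕ} (hk : k ≠ 0) (N : ℕ) :
    (∑ m ∈ Ioc 0 N, omegaPow (1 / k) m / m) ^ k ≤ ∑ a ∈ Ioc 0 (N ^ k), (1 : ℝ) / a := by
  rw [sum_pow']
  have hmap : ∀ p ∈ Fintype.piFinset fun _ : Fin k => Ioc 0 N, ∏ i, p i ∈ Ioc 0 (N ^ k) := by
    intro p hp
    simp only [Fintype.mem_piFinset, mem_Ioc] at hp
    rw [mem_Ioc]
    refine ⟨prod_pos fun i _ => (hp i).1, ?_⟩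
    calc ∏ i, p i ≤ ∏ _i : Fin k, N := prod_le_prod' fun i _ => (hp i).2
      _ = N ^ k := by simp
  rw [← sum_fiberwise_of_maps_to hmap]
  refine sum_le_sum fun a ha => ?_
  have ha0 : a ≠ 0 := (mem_Ioc.1 ha).1.ne'
  have hterm : ∀ p ∈ {p ∈ Fintype.piFinset fun _ : Fin k => Ioc 0 N | ∏ i, p i = a},
      ∏ i, omegaPow (1 / k) (p i) / (p i : ℝ) = (1 / k : ℝ) ^ cardFactors a / a := by
    intro p hp
    rw [mem_filter] at hp
    rw [prod_div_distrib, ← omegaPow_prod, ← Nat.cast_prod, hp.2, omegaPow_apply _ ha0]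
  rw [sum_congr rfl hterm, sum_const, nsmul_eq_mul]
  have hcard : #{p ∈ Fintype.piFinset fun _ : Fin k => Ioc 0 N | ∏ i, p i = a} ≤
      k ^ cardFactors a := by
    refine (card_le_card ?_).trans (Nat.card_finMulAntidiag_le k a ha0)
    intro p hp
    rw [mem_filter] at hp
    exact Nat.mem_finMulAntidiag.2 ⟨hp.2, ha0⟩
  have hcard' : (#{p ∈ Fintype.piFinset fun _ : Fin k => Ioc 0 N | ∏ i, p i = a} : ℝ) ≤
      (k : ℝ) ^ cardFactors a := mod_cast hcard
  calc _ ≤ (k : ℝ) ^ cardFactors a * ((1 / k : ℝ) ^ cardFactors a / a) := by gcongr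
    _ = 1 / a := by
      have : (k : ℝ) ≠ 0 := mod_cast hk
      rw [← mul_div_assoc, ← mul_pow, mul_one_div_cancel this, one_pow]

/-- For squarefree `a` the count `k^Ω(a)` is exact, and all factors of `a ≤ N` stay in range. -/
theorem sum_squarefree_le_pow {k : ℕ} (hk : k ≠ 0) (N : ℕ) :
    ∑ a ∈ Ioc 0 N with Squarefree a, (1 : ℝ) / a ≤
      (∑ m ∈ Ioc 0 N, omegaPow (1 / k) m / m) ^ k := by
  have hk0 : (k : ℝ) ≠ 0 := mod_cast hk
  rw [sum_pow']
  have hdis : ((Ioc 0 N).filter Squarefree : Set ℕ).PairwiseDisjoint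
      (fun a => k.finMulAntidiag a) := by
    intro a _ b _ hab
    rw [Function.onFun, disjoint_left]
    intro p hp hq
    exact hab ((Nat.mem_finMulAntidiag.1 hp).1.symm.trans (Nat.mem_finMulAntidiag.1 hq).1)
  calc ∑ a ∈ Ioc 0 N with Squarefree a, (1 : ℝ) / a
      = ∑ a ∈ Ioc 0 N with Squarefree a, ∑ p ∈ k.finMulAntidiag a,
          ∏ i, omegaPow (1 / k) (p i) / (p i : ℝ) := by
        refine sum_congr rfl fun a ha => ?_
        rw [mem_filter, mem_Ioc] at ha
        have hterm : ∀ p ∈ k.finMulAntidiag a,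
            ∏ i, omegaPow (1 / k) (p i) / (p i : ℝ) = (1 / k : ℝ) ^ cardFactors a / a := by
          intro p hp
          rw [Nat.mem_finMulAntidiag] at hp
          rw [prod_div_distrib, ← omegaPow_prod, ← Nat.cast_prod, hp.1, omegaPow_apply _ hp.2]
        rw [sum_congr rfl hterm, sum_const, nsmul_eq_mul,
          Nat.card_finMulAntidiag_of_squarefree ha.2,
          (cardDistinctFactors_eq_cardFactors_iff_squarefree ha.1.1.ne').2 ha.2]
        push_cast
        rw [← mul_div_assoc, ← mul_pow, mul_one_div_cancel hk0, one_pow]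
    _ = ∑ p ∈ ((Ioc 0 N).filter Squarefree).biUnion (fun a => k.finMulAntidiag a),
          ∏ i, omegaPow (1 / k) (p i) / (p i : ℝ) := (sum_biUnion hdis).symm
    _ ≤ _ := by
        refine sum_le_sum_of_subset_of_nonneg ?_ fun p _ _ =>
          prod_nonneg fun i _ => div_nonneg (omegaPow_nonneg (by positivity) _) (by positivity)
        intro p hp
        rw [mem_biUnion] at hp
        obtain ⟨a, ha, hp⟩ := hp
        rw [mem_filter, mem_Ioc] at ha
        rw [Fintype.mem_piFinset]
        intro i
        have hd : p i ∣ a := Nat.dvd_of_mem_finMulAntidiag hp i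
        exact mem_Ioc.2 ⟨Nat.pos_of_dvd_of_pos hd ha.1.1, (Nat.le_of_dvd ha.1.1 hd).trans ha.1.2⟩

/-! ### Harmonic sums over all integers and over squarefree integers -/

theorem sum_Ioc_one_div_le (N : ℕ) : ∑ a ∈ Ioc 0 N, (1 : ℝ) / a ≤ 1 + Real.log N := by
  have h := harmonic_le_one_add_log N
  rw [harmonic_eq_sum_Icc] at h
  push_cast at h
  simpa [← Finset.Icc_succ_left_eq_Ioc] using h

theorem log_le_sum_Ioc_one_div (N : ℕ) : Real.log (N + 1) ≤ ∑ a ∈ Ioc 0 N, (1 : ℝ) / a := by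
  have h := log_add_one_le_harmonic N
  rw [harmonic_eq_sum_Icc] at h
  push_cast at h
  simpa [← Finset.Icc_succ_left_eq_Ioc] using h

theorem sum_Ioc_one_div_sq_le (m N : ℕ) (hm : m ≠ 0) :
    ∑ d ∈ Ioc m N, (1 : ℝ) / (d : ℝ) ^ 2 ≤ 1 / m := by
  rcases le_or_gt m N with h | h
  · have := sum_Ioc_inv_sq_le_sub (α := ℝ) hm h
    have h2 : (0 : ℝ) ≤ (N : ℝ)⁻¹ := by positivity
    simp only [one_div]
    linarith
  · rw [Ioc_eq_empty_of_le h.le]; simp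

/-- Writing each integer as `b² a` with `a` squarefree bounds the harmonic sum by the squarefree one
times `∑ 1/b² ≤ 2`. -/
theorem log_div_two_le_sum_squarefree (N : ℕ) :
    Real.log (N + 1) / 2 ≤ ∑ a ∈ Ioc 0 N with Squarefree a, (1 : ℝ) / a := by
  have hsq : ∑ b ∈ Ioc 0 N, (1 : ℝ) / (b : ℝ) ^ 2 ≤ 2 := by
    rcases Nat.eq_zero_or_pos N with rfl | hN
    · simp
    have := sum_Ioc_one_div_sq_le 1 N one_ne_zero
    rw [← sum_Ioc_consecutive _ (Nat.zero_le 1) hN]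
    simp at this ⊢
    linarith
  have hsub : Ioc 0 N ⊆ (((Ioc 0 N).filter Squarefree) ×ˢ Ioc 0 N).image
      (fun q : ℕ × ℕ => q.2 ^ 2 * q.1) := by
    intro n hn
    obtain ⟨a, b, hab, ha⟩ := Nat.sq_mul_squarefree n
    rw [mem_Ioc] at hn
    have h0 : b ^ 2 * a ≠ 0 := by rw [hab]; exact hn.1.ne'
    have ha0 : a ≠ 0 := right_ne_zero_of_mul h0
    have hb0 : b ≠ 0 := by rintro rfl; simp at h0
    simp only [mem_image, mem_product, mem_filter, mem_Ioc, Prod.exists]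
    refine ⟨a, b, ⟨⟨⟨Nat.pos_of_ne_zero ha0, ?_⟩, ha⟩, Nat.pos_of_ne_zero hb0, ?_⟩, hab⟩
    · exact (Nat.le_of_dvd hn.1 ⟨b ^ 2, by rw [← hab]; ring⟩).trans hn.2
    · exact (Nat.le_of_dvd hn.1 ⟨b * a, by rw [← hab]; ring⟩).trans hn.2
  have h1 := log_le_sum_Ioc_one_div N
  have h2 : ∑ a ∈ Ioc 0 N, (1 : ℝ) / a ≤
      (∑ a ∈ Ioc 0 N with Squarefree a, (1 : ℝ) / a) * ∑ b ∈ Ioc 0 N, (1 : ℝ) / (b : ℝ) ^ 2 := by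
    calc ∑ a ∈ Ioc 0 N, (1 : ℝ) / a
        ≤ ∑ a ∈ (((Ioc 0 N).filter Squarefree) ×ˢ Ioc 0 N).image (fun q : ℕ × ℕ => q.2 ^ 2 * q.1),
            (1 : ℝ) / (a : ℕ) := sum_le_sum_of_subset_of_nonneg hsub fun _ _ _ => by positivity
      _ ≤ ∑ q ∈ ((Ioc 0 N).filter Squarefree) ×ˢ Ioc 0 N, (1 : ℝ) / ((q.2 ^ 2 * q.1 : ℕ) : ℝ) :=
          sum_image_le_of_nonneg (f := fun a : ℕ => (1 : ℝ) / a) fun _ _ => by positivity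
      _ = _ := by
          rw [sum_mul_sum, sum_product]
          refine sum_congr rfl fun a _ => sum_congr rfl fun b _ => ?_
          push_cast
          rw [div_mul_div_comm, mul_one, mul_comm]
  have h0 : 0 ≤ ∑ a ∈ Ioc 0 N with Squarefree a, (1 : ℝ) / (a : ℝ) :=
    sum_nonneg fun _ _ => by positivity
  nlinarith [mul_le_mul_of_nonneg_left hsq h0]

/-! ### Chebyshev bounds and the summatory functions of the weights -/

theorem exists_mul_le_theta : ∃ c : ℝ, 0 < c ∧ ∀ n : ℕ, 2 ≤ n → c * n ≤ Chebyshev.theta n := by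
  have hlim : Filter.Tendsto (fun x : ℝ => (Real.log (x + 1) + 2 * √x * Real.log x) / x)
      Filter.atTop (nhds 0) := by
    have h1 : (fun x : ℝ => Real.log (x + 1)) =o[Filter.atTop] (fun x : ℝ => x) := by
      have : (fun x : ℝ => Real.log (x + 1)) =o[Filter.atTop] (fun x : ℝ => x + 1) :=
        Real.isLittleO_log_id_atTop.comp_tendsto
          (Filter.tendsto_atTop_add_const_right _ 1 Filter.tendsto_id)
      refine this.trans_isBigO ?_
      refine Asymptotics.IsBigO.of_bound 2 ?_
      filter_upwards [Filter.eventually_ge_atTop 1] with x hx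
      rw [Real.norm_of_nonneg (by linarith), Real.norm_of_nonneg (by linarith)]
      linarith
    have h2 : (fun x : ℝ => 2 * √x * Real.log x) =o[Filter.atTop] (fun x : ℝ => x) := by
      have h3 : (fun x : ℝ => Real.log x) =o[Filter.atTop] (fun x : ℝ => x ^ (1 / 2 : ℝ)) :=
        isLittleO_log_rpow_atTop (by norm_num)
      have h4 : (fun x : ℝ => 2 * √x) =O[Filter.atTop] (fun x : ℝ => x ^ (1 / 2 : ℝ)) := by
        simp_rw [← Real.sqrt_eq_rpow]
        exact (Asymptotics.isBigO_refl _ _).const_mul_left 2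
      refine (h4.mul_isLittleO h3).congr' (Filter.EventuallyEq.rfl) ?_
      filter_upwards [Filter.eventually_ge_atTop 0] with x hx
      rw [← Real.sqrt_eq_rpow, Real.mul_self_sqrt hx]
    exact (h1.add h2).tendsto_div_nhds_zero
  have hev := (hlim.comp tendsto_natCast_atTop_atTop).eventually
    (gt_mem_nhds (show (0 : ℝ) < 1 / 2 by norm_num))
  obtain ⟨N, hN⟩ := Filter.eventually_atTop.1 hev
  have hlog2 : 0.6931471803 < Real.log 2 := Real.log_two_gt_d9
  have hNpos : (0 : ℝ) < N + 10 := by positivity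
  -- The `10` suits `n ≥ N`, where the error term is below `n/2`; the `N` makes the bound at most
  -- `log 2 = θ(2)` when `n < N`.
  refine ⟨Real.log 2 / (N + 10), by positivity, fun n hn => ?_⟩
  have hn0 : (0 : ℝ) < n := by positivity
  rcases le_or_gt N n with h | h
  · have h1 := hN n h
    simp only [Function.comp_apply] at h1
    rw [div_lt_iff₀ hn0] at h1
    have h2 := Chebyshev.theta_ge n
    have h3 : Real.log 2 / (N + 10) ≤ Real.log 2 / 10 := by
      apply div_le_div_of_nonneg_left (by linarith) (by norm_num)
      have : (0 : ℝ) ≤ N := by positivity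
      linarith
    have h4 := mul_le_mul_of_nonneg_right h3 hn0.le
    nlinarith
  · have h1 : Real.log 2 ≤ Chebyshev.theta n := by
      have h2 : Chebyshev.theta 2 ≤ Chebyshev.theta n := Chebyshev.theta_mono (by exact_mod_cast hn)
      have h3 : Chebyshev.theta 2 = Real.log 2 := by
        have : (Ioc 0 2).filter Nat.Prime = {2} := by decide
        simp [Chebyshev.theta, this]
      linarith
    have h2 : (n : ℝ) ≤ N := by exact_mod_cast h.le
    rw [div_mul_eq_mul_div, div_le_iff₀ hNpos]
    nlinarith

/-- Split `log N = log m + log (N/m)`. The first part is `O(N T)` by the convolution identity and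
Chebyshev's bound for `ψ`, the second by `log y ≤ y`; and `T² ≪ log N`. -/
theorem exists_sum_omegaPow_half_le : ∃ C : ℝ, 0 < C ∧ ∀ N : ℕ, 2 ≤ N →
    ∑ m ∈ Ioc 0 N, omegaPow (1 / 2) m ≤ C * N / √(Real.log N) := by
  refine ⟨2 * (Real.log 4 + 5), by positivity, fun N hN => ?_⟩
  set f := omegaPow (1 / 2) with hf
  set T := ∑ m ∈ Ioc 0 N, f m / m with hT
  have hf0 : ∀ n, 0 ≤ f n := omegaPow_nonneg (by norm_num)
  have hN0 : (0 : ℝ) < N := by positivity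
  have hlogN : Real.log 2 ≤ Real.log N :=
    Real.log_le_log (by norm_num) (by exact_mod_cast hN)
  have hlog2 : 0.6931471803 < Real.log 2 := Real.log_two_gt_d9
  have hl0 : 0 < Real.log N := by linarith
  have hT0 : 0 ≤ T := sum_nonneg fun _ _ => div_nonneg (hf0 _) (by positivity)
  have h1 : ∑ m ∈ Ioc 0 N, f m * Real.log m ≤ (Real.log 4 + 4) * N * T := by
    rw [hf, sum_omegaPow_mul_log, hT, mul_sum]
    refine sum_le_sum fun k hk => ?_
    have hpsi : ∑ d ∈ Ioc 0 (N / k), f d * vonMangoldt d ≤ (Real.log 4 + 4) * (N / k) := by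
      calc ∑ d ∈ Ioc 0 (N / k), f d * vonMangoldt d
          ≤ ∑ d ∈ Ioc 0 (N / k), vonMangoldt d := sum_le_sum fun d _ =>
            mul_le_of_le_one_left vonMangoldt_nonneg
              (omegaPow_le_one (by norm_num) (by norm_num) d)
        _ = Chebyshev.psi ((N / k : ℕ) : ℝ) := by simp [Chebyshev.psi]
        _ ≤ (Real.log 4 + 4) * ((N / k : ℕ) : ℝ) := Chebyshev.psi_le_const_mul_self (by positivity)
        _ ≤ _ := by gcongr; exact Nat.cast_div_le
    calc _ ≤ f k * ((Real.log 4 + 4) * (N / k)) := mul_le_mul_of_nonneg_left hpsi (hf0 k)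
      _ = _ := by ring
  have h2 : ∑ m ∈ Ioc 0 N, f m * (Real.log N - Real.log m) ≤ N * T := by
    rw [hT, mul_sum]
    refine sum_le_sum fun m hm => ?_
    have hm0 : (0 : ℝ) < m := by exact_mod_cast (mem_Ioc.1 hm).1
    rw [← Real.log_div hN0.ne' hm0.ne']
    calc f m * Real.log (N / m) ≤ f m * (N / m) :=
          mul_le_mul_of_nonneg_left (Real.log_le_self (by positivity)) (hf0 m)
      _ = _ := by ring
  have h3 : Real.log N * ∑ m ∈ Ioc 0 N, f m ≤ (Real.log 4 + 5) * N * T := by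
    have : Real.log N * ∑ m ∈ Ioc 0 N, f m = ∑ m ∈ Ioc 0 N, f m * Real.log m +
        ∑ m ∈ Ioc 0 N, f m * (Real.log N - Real.log m) := by
      rw [← sum_add_distrib, mul_sum]
      exact sum_congr rfl fun _ _ => by ring
    linarith
  have h4 : T ≤ 2 * √(Real.log N) := by
    have h5 : T ^ 2 ≤ 4 * Real.log N := by
      have h6 := pow_sum_omegaPow_div_le (k := 2) two_ne_zero N
      have h7 := sum_Ioc_one_div_le (N ^ 2)
      push_cast at h6 h7
      rw [Real.log_pow] at h7
      push_cast at h7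
      linarith
    refine abs_le_of_sq_le_sq' ?_ (by positivity) |>.2
    rw [mul_pow, Real.sq_sqrt hl0.le]
    linarith
  rw [le_div_iff₀ (Real.sqrt_pos.2 hl0)]
  have hs : √(Real.log N) * √(Real.log N) = Real.log N := Real.mul_self_sqrt hl0.le
  have hs0 : 0 < √(Real.log N) := Real.sqrt_pos.2 hl0
  refine le_of_mul_le_mul_right ?_ hs0
  calc _ = Real.log N * ∑ m ∈ Ioc 0 N, f m := by rw [mul_assoc, hs, mul_comm]
    _ ≤ (Real.log 4 + 5) * N * T := h3
    _ ≤ (Real.log 4 + 5) * N * (2 * √(Real.log N)) := by gcongr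
    _ = _ := by ring

/-- The same convolution read from below: only primes are kept in the inner sum, and `k ≤ N/2`
ensures `N/k ≥ 2`, where the bound for `θ` applies. Then `T³ ≫ log N` by the squarefree comparison.
-/
theorem exists_le_sum_omegaPow_third : ∃ c : ℝ, 0 < c ∧ ∀ N : ℕ, 2 ≤ N →
    c * N ^ 3 / Real.log N ^ 2 ≤ (∑ m ∈ Ioc 0 N, omegaPow (1 / 3) m) ^ 3 := by
  obtain ⟨c, hc, hth⟩ := exists_mul_le_theta
  refine ⟨(c / 6) ^ 3 / 4, by positivity, fun N hN => ?_⟩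
  set f := omegaPow (1 / 3) with hf
  set T := ∑ m ∈ Ioc 0 (N / 2), f m / m with hT
  have hf0 : ∀ n, 0 ≤ f n := omegaPow_nonneg (by norm_num)
  have hN0 : (0 : ℝ) < N := by positivity
  have hl0 : 0 < Real.log N := Real.log_pos (by exact_mod_cast hN)
  have hT0 : 0 ≤ T := sum_nonneg fun _ _ => div_nonneg (hf0 _) (by positivity)
  have hinner : ∀ n : ℕ, 1 / 3 * Chebyshev.theta n ≤ ∑ d ∈ Ioc 0 n, f d * vonMangoldt d := by
    intro n
    rw [Chebyshev.theta, Nat.floor_natCast, mul_sum]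
    calc ∑ p ∈ Ioc 0 n with p.Prime, 1 / 3 * Real.log p
        = ∑ p ∈ Ioc 0 n with p.Prime, f p * vonMangoldt p := by
          refine sum_congr rfl fun p hp => ?_
          have hp' := (mem_filter.1 hp).2
          rw [vonMangoldt_apply_prime hp', hf, omegaPow_apply _ hp'.ne_zero,
            cardFactors_apply_prime hp', pow_one]
      _ ≤ _ := sum_le_sum_of_subset_of_nonneg (filter_subset _ _) fun _ _ _ =>
          mul_nonneg (hf0 _) vonMangoldt_nonneg
  have h1 : c / 6 * N * T ≤ ∑ m ∈ Ioc 0 N, f m * Real.log m := by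
    rw [hf, sum_omegaPow_mul_log, hT, mul_sum]
    refine (sum_le_sum fun k hk => ?_).trans
      (sum_le_sum_of_subset_of_nonneg (Ioc_subset_Ioc_right (Nat.div_le_self N 2)) ?_)
    · have hk0 : 0 < k := (mem_Ioc.1 hk).1
      have hk2 : 2 ≤ N / k := by
        rw [Nat.le_div_iff_mul_le hk0]
        have := (Nat.le_div_iff_mul_le two_pos).1 (mem_Ioc.1 hk).2
        omega
      have h2 : (N : ℝ) / k ≤ 2 * (N / k : ℕ) := by
        rw [div_le_iff₀ (by exact_mod_cast hk0)]
        have h3 : N < (N / k + 1) * k := Nat.lt_mul_of_div_lt (Nat.lt_succ_self _) hk0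
        have h4 : N ≤ 2 * (N / k) * k := by nlinarith
        exact_mod_cast h4
      calc c / 6 * N * (f k / k) = f k * (c / 6 * (N / k)) := by ring
        _ ≤ f k * (c / 6 * (2 * (N / k : ℕ))) := by have := hf0 k; gcongr
        _ = f k * (1 / 3 * (c * (N / k : ℕ))) := by ring
        _ ≤ f k * (1 / 3 * Chebyshev.theta (N / k : ℕ)) := by
            have := hf0 k
            have := hth _ hk2
            gcongr
        _ ≤ _ := mul_le_mul_of_nonneg_left (hinner _) (hf0 k)
    · exact fun k _ _ => mul_nonneg (hf0 k)
        (sum_nonneg fun d _ => mul_nonneg (hf0 d) vonMangoldt_nonneg)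
  have h2 : ∑ m ∈ Ioc 0 N, f m * Real.log m ≤ Real.log N * ∑ m ∈ Ioc 0 N, f m := by
    rw [mul_sum]
    refine sum_le_sum fun m hm => ?_
    rw [mul_comm]
    have hm0 : (0 : ℝ) < m := by exact_mod_cast (mem_Ioc.1 hm).1
    exact mul_le_mul_of_nonneg_right
      (Real.log_le_log hm0 (by exact_mod_cast (mem_Ioc.1 hm).2)) (hf0 m)
  have h3 : Real.log N / 4 ≤ T ^ 3 := by
    have h4 := sum_squarefree_le_pow (k := 3) three_ne_zero (N / 2)
    have h5 := log_div_two_le_sum_squarefree (N / 2)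
    push_cast at h4
    have h6 : Real.log N / 2 ≤ Real.log ((N / 2 : ℕ) + 1) := by
      have h7 : (N : ℝ) ≤ (((N / 2 : ℕ) : ℝ) + 1) ^ 2 := by
        have h8 : N ≤ (N / 2 + 1) ^ 2 := by
          have : N ≤ 2 * (N / 2) + 1 := by omega
          nlinarith
        exact_mod_cast h8
      have h9 := Real.log_le_log hN0 h7
      rw [Real.log_pow] at h9
      push_cast at h9
      linarith
    linarith
  have h4 : c / 6 * N * T / Real.log N ≤ ∑ m ∈ Ioc 0 N, f m := by
    rw [div_le_iff₀ hl0]; linarith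
  calc (c / 6) ^ 3 / 4 * N ^ 3 / Real.log N ^ 2
      = (c / 6 * N / Real.log N) ^ 3 * (Real.log N / 4) := by field_simp
    _ ≤ (c / 6 * N / Real.log N) ^ 3 * T ^ 3 := by gcongr
    _ = (c / 6 * N * T / Real.log N) ^ 3 := by ring
    _ ≤ _ := pow_le_pow_left₀ (by positivity) h4 3

/-! ### Weighted double counting of quadruples -/

theorem sum_omegaPow_prod_mem_le (k : ℕ) (hk : k ≠ 0) (s B : Finset ℕ) (hB : 0 ∉ B) :
    ∑ q ∈ Fintype.piFinset fun _ : Fin k => s,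
      (if ∏ i, q i ∈ B then ∏ i, omegaPow (1 / k) (q i) else 0) ≤ #B := by
  have hk0 : (k : ℝ) ≠ 0 := mod_cast hk
  rw [← sum_filter]
  have hmap : ∀ q ∈ (Fintype.piFinset fun _ : Fin k => s).filter (fun q => ∏ i, q i ∈ B),
      ∏ i, q i ∈ B := fun q hq => (mem_filter.1 hq).2
  rw [← sum_fiberwise_of_maps_to hmap, card_eq_sum_ones, Nat.cast_sum, Nat.cast_one]
  refine sum_le_sum fun a ha => ?_
  have ha0 : a ≠ 0 := fun h => hB (h ▸ ha)
  have hterm : ∀ q ∈ ((Fintype.piFinset fun _ : Fin k => s).filter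
      (fun q => ∏ i, q i ∈ B)).filter (fun q => ∏ i, q i = a),
      ∏ i, omegaPow (1 / k) (q i) = (1 / k : ℝ) ^ cardFactors a := by
    intro q hq
    rw [← omegaPow_prod, (mem_filter.1 hq).2, omegaPow_apply _ ha0]
  rw [sum_congr rfl hterm, sum_const, nsmul_eq_mul]
  have hcard : #(((Fintype.piFinset fun _ : Fin k => s).filter
      (fun q => ∏ i, q i ∈ B)).filter (fun q => ∏ i, q i = a)) ≤ k ^ cardFactors a := by
    refine (card_le_card ?_).trans (Nat.card_finMulAntidiag_le k a ha0)
    intro q hq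
    exact Nat.mem_finMulAntidiag.2 ⟨(mem_filter.1 hq).2, ha0⟩
  calc _ ≤ (k : ℝ) ^ cardFactors a * (1 / k : ℝ) ^ cardFactors a :=
        mul_le_mul_of_nonneg_right (by exact_mod_cast hcard) (by positivity)
    _ = 1 := by rw [← mul_pow, mul_one_div_cancel hk0, one_pow]

theorem sum_piFinset_succAbove {k : ℕ} (i : Fin (k + 1)) (s : Finset ℕ) (w : ℕ → ℝ)
    (h : (Fin k → ℕ) → ℝ) :
    ∑ b ∈ Fintype.piFinset fun _ : Fin (k + 1) => s, w (b i) * h (fun j => b (i.succAbove j)) =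
      (∑ m ∈ s, w m) * ∑ q ∈ Fintype.piFinset fun _ : Fin k => s, h q := by
  rw [sum_mul_sum, ← sum_product']
  refine sum_nbij' (fun b => (b i, fun j => b (i.succAbove j)))
    (fun q => i.insertNth (α := fun _ => ℕ) q.1 q.2) ?_ ?_ ?_ ?_ ?_
  · intro b hb
    simp only [Fintype.mem_piFinset, mem_product] at hb ⊢
    exact ⟨hb i, fun j => hb _⟩
  · intro q hq
    simp only [Fintype.mem_piFinset, mem_product] at hq ⊢
    intro j
    refine Fin.succAboveCases i ?_ (fun j => ?_) j
    · simpa using hq.1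
    · simpa using hq.2 j
  · intro b _
    exact Fin.insertNth_self_removeNth i b
  · intro q _
    simp
  · intro b _
    rfl

/-- On the diagonal, coordinate `i` is determined by the others and its own weight is at most 1, so
it can be dropped. -/
theorem sum_piFinset_eq_le {k : ℕ} {i j : Fin (k + 1)} (hij : i ≠ j) (s : Finset ℕ) (w : ℕ → ℝ)
    (hw : ∀ n, 0 ≤ w n) (hw1 : ∀ n, w n ≤ 1) :
    ∑ b ∈ Fintype.piFinset fun _ : Fin (k + 1) => s, (if b i = b j then ∏ l, w (b l) else 0) ≤
      (∑ m ∈ s, w m) ^ k := by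
  rw [← sum_filter, sum_pow']
  calc ∑ b ∈ (Fintype.piFinset fun _ : Fin (k + 1) => s).filter (fun b => b i = b j),
          ∏ l, w (b l)
      ≤ ∑ b ∈ (Fintype.piFinset fun _ : Fin (k + 1) => s).filter (fun b => b i = b j),
          ∏ l, w (b (i.succAbove l)) := by
        refine sum_le_sum fun b _ => ?_
        rw [Fin.prod_univ_succAbove _ i]
        exact mul_le_of_le_one_left (prod_nonneg fun _ _ => hw _) (hw1 _)
    _ = ∑ q ∈ ((Fintype.piFinset fun _ : Fin (k + 1) => s).filter (fun b => b i = b j)).image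
          (fun b l => b (i.succAbove l)), ∏ l, w (q l) := by
        rw [sum_image]
        intro b hb b' hb' h
        have hb := (mem_filter.1 hb).2
        have hb' := (mem_filter.1 hb').2
        have hne : ∀ l, l ≠ i → b l = b' l := by
          intro l hl
          obtain ⟨m, rfl⟩ := Fin.exists_succAbove_eq hl
          exact congrFun h m
        ext l
        by_cases hl : l = i
        · rw [hl, hb, hb', hne j hij.symm]
        · exact hne l hl
    _ ≤ _ := by
        refine sum_le_sum_of_subset_of_nonneg ?_ fun _ _ _ => prod_nonneg fun _ _ => hw _
        intro q hq
        obtain ⟨b, hb, rfl⟩ := mem_image.1 hq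
        rw [mem_filter, Fintype.mem_piFinset] at hb
        exact Fintype.mem_piFinset.2 fun l => hb.1 _

/-- If the four products of three of the numbers `b 0, …, b 3` lie in `A`, then `A` fails `P_{4,3}`. -/
theorem not_propertyP_of_prod_succAbove_mem {A : Set ℕ} {b : Fin 4 → ℕ} (hb : Function.Injective b)
    (hpos : ∀ i, 0 < b i) (hA : ∀ i : Fin 4, ∏ j, b (i.succAbove j) ∈ A) : ¬ PropertyP 4 3 A := by
  intro hP
  apply hP
  set a : Fin 4 → ℕ := fun i => ∏ j, b (i.succAbove j) with ha
  have hprod : ∀ i, b i * a i = ∏ j, b j := fun i => (Fin.prod_univ_succAbove b i).symm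
  have hBpos : 0 < ∏ j, b j := prod_pos fun j _ => hpos j
  have hainj : Function.Injective a := by
    intro i j hij
    apply hb
    have h1 := hprod i
    rw [← hprod j, hij] at h1
    refine Nat.eq_of_mul_eq_mul_right (Nat.pos_of_ne_zero ?_) h1
    intro h0
    have := hprod j
    rw [h0, mul_zero] at this
    omega
  have hcard : #(univ.image a) = 4 := by rw [card_image_of_injective _ hainj]; simp
  -- The `aᵢ` are distinct but unordered; their increasing enumeration has the same product.
  refine ⟨(univ.image a).orderEmbOfFin hcard, ∏ j, b j, fun i => ?_,
    ((univ.image a).orderEmbOfFin hcard).strictMono, ?_⟩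
  · obtain ⟨l, -, hl⟩ := mem_image.1 ((univ.image a).orderEmbOfFin_mem hcard i)
    rw [← hl]; exact hA l
  · have h1 : ∏ i, (univ.image a).orderEmbOfFin hcard i = ∏ i, a i := by
      have h2 : univ.image ((univ.image a).orderEmbOfFin hcard) = univ.image a := by
        apply Finset.coe_injective
        simp
      calc _ = ∏ x ∈ univ.image ((univ.image a).orderEmbOfFin hcard), x :=
            (prod_image fun _ _ _ _ h => ((univ.image a).orderEmbOfFin hcard).injective h).symm
        _ = ∏ x ∈ univ.image a, x := by rw [h2]
        _ = _ := prod_image fun _ _ _ _ h => hainj h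
    have h3 : (∏ j, b j) * ∏ i, a i = (∏ j, b j) * (∏ j, b j) ^ 3 := by
      rw [← prod_mul_distrib, prod_congr rfl fun i _ => hprod i]
      simp
      ring
    have h4 := Nat.eq_of_mul_eq_mul_left hBpos h3
    rw [← h1] at h4
    exact_mod_cast h4

theorem omegaPow_sum_pow_le_card {n N : ℕ} (hN : N ^ 3 ≤ n) {A : Finset ℕ} (hA : A ⊆ Icc 1 n)
    (hP : PropertyP 4 3 (A : Set ℕ)) :
    (∑ m ∈ Ioc 0 N, omegaPow (1 / 3) m) ^ 3 ≤
      6 * (∑ m ∈ Ioc 0 N, omegaPow (1 / 3) m) ^ 2 + 4 * ((n : ℝ) - #A) := by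
  classical
  set w := omegaPow (1 / 3) with hw
  set W := ∑ m ∈ Ioc 0 N, w m with hW
  have hw0 : ∀ n, 0 ≤ w n := omegaPow_nonneg (by norm_num)
  have hw1 : ∀ n, w n ≤ 1 := omegaPow_le_one (by norm_num) (by norm_num)
  set B := Icc 1 n \ A with hB
  have hBcard : (#B : ℝ) = n - #A := by
    rw [hB, card_sdiff_of_subset hA, Nat.cast_sub (card_le_card hA)]; simp
  have hB0 : 0 ∉ B := by simp [hB]
  rw [← hBcard]
  rcases Nat.eq_zero_or_pos N with rfl | hNpos
  · simp [hW]
  have hWpos : 0 < W := by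
    have h1 : w 1 ≤ W := single_le_sum (fun i _ => hw0 i) (mem_Ioc.2 ⟨one_pos, hNpos⟩)
    rw [hw, omegaPow_one] at h1
    linarith
  set E : Finset (Fin 4 × Fin 4) := {(0, 1), (0, 2), (0, 3), (1, 2), (1, 3), (2, 3)} with hE
  -- Every quadruple either repeats a coordinate, at one of the six pairs in `E`, or has a triple
  -- product in the complement `B`.
  have key : W ^ 4 ≤ ∑ b ∈ Fintype.piFinset fun _ : Fin 4 => Ioc 0 N,
      (∑ e ∈ E, (if b e.1 = b e.2 then ∏ l, w (b l) else 0) +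
        ∑ i : Fin 4, w (b i) * (if ∏ j, b (i.succAbove j) ∈ B then
          ∏ j, w (b (i.succAbove j)) else 0)) := by
    rw [hW, sum_pow']
    refine sum_le_sum fun b hb => ?_
    rw [Fintype.mem_piFinset] at hb
    have hp0 : 0 ≤ ∏ l, w (b l) := prod_nonneg fun _ _ => hw0 _
    have hs1 : ∀ e ∈ E, 0 ≤ (if b e.1 = b e.2 then ∏ l, w (b l) else 0) := by
      intro e _; split_ifs <;> simp [hp0]
    have hs2 : ∀ i ∈ (univ : Finset (Fin 4)), 0 ≤ w (b i) *
        (if ∏ j, b (i.succAbove j) ∈ B then ∏ j, w (b (i.succAbove j)) else 0) := by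
      intro i _
      refine mul_nonneg (hw0 _) ?_
      split_ifs
      · exact prod_nonneg fun _ _ => hw0 _
      · exact le_rfl
    by_cases hex : ∃ e ∈ E, b e.1 = b e.2
    · obtain ⟨e, he, hbe⟩ := hex
      have := single_le_sum hs1 he
      rw [if_pos hbe] at this
      linarith [sum_nonneg hs2]
    · have hinj : Function.Injective b := by
        have hne : ∀ e ∈ E, b e.1 ≠ b e.2 := fun e he h => hex ⟨e, he, h⟩
        simp only [hE, mem_insert, mem_singleton, forall_eq_or_imp, forall_eq] at hne
        obtain ⟨h1, h2, h3, h4, h5, h6⟩ := hne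
        intro i j hij
        fin_cases i <;> fin_cases j <;> simp_all
      have hex2 : ∃ i : Fin 4, ∏ j, b (i.succAbove j) ∈ B := by
        by_contra hcon
        push Not at hcon
        refine not_propertyP_of_prod_succAbove_mem hinj (fun i => (mem_Ioc.1 (hb i)).1) (fun i => ?_) hP
        have h1 := hcon i
        rw [hB, mem_sdiff, not_and, not_not] at h1
        refine h1 (mem_Icc.2 ⟨Nat.one_le_iff_ne_zero.2 (prod_pos fun j _ =>
          (mem_Ioc.1 (hb _)).1).ne', ?_⟩)
        calc _ ≤ ∏ _j : Fin 3, N := prod_le_prod' fun j _ => (mem_Ioc.1 (hb _)).2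
          _ = N ^ 3 := by simp
          _ ≤ n := hN
      obtain ⟨i, hi⟩ := hex2
      have := single_le_sum hs2 (mem_univ i)
      rw [if_pos hi, ← Fin.prod_univ_succAbove (fun l => w (b l)) i] at this
      linarith [sum_nonneg hs1]
  rw [sum_add_distrib, sum_comm, sum_comm (t := (univ : Finset (Fin 4)))] at key
  have hb1 : ∑ e ∈ E, ∑ b ∈ Fintype.piFinset fun _ : Fin 4 => Ioc 0 N,
      (if b e.1 = b e.2 then ∏ l, w (b l) else 0) ≤ 6 * W ^ 3 := by
    have : ∀ e ∈ E, ∑ b ∈ Fintype.piFinset fun _ : Fin 4 => Ioc 0 N,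
        (if b e.1 = b e.2 then ∏ l, w (b l) else 0) ≤ W ^ 3 := by
      intro e he
      refine sum_piFinset_eq_le ?_ _ w hw0 hw1
      revert e
      simp only [hE]
      decide
    refine (sum_le_card_nsmul _ _ _ this).trans_eq ?_
    rw [nsmul_eq_mul, show #E = 6 by simp only [hE]; decide]
    norm_num
  have hb2 : ∑ i : Fin 4, ∑ b ∈ Fintype.piFinset fun _ : Fin 4 => Ioc 0 N,
      w (b i) * (if ∏ j, b (i.succAbove j) ∈ B then ∏ j, w (b (i.succAbove j)) else 0) ≤
      4 * (W * #B) := by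
    have : ∀ i ∈ (univ : Finset (Fin 4)), ∑ b ∈ Fintype.piFinset fun _ : Fin 4 => Ioc 0 N,
        w (b i) * (if ∏ j, b (i.succAbove j) ∈ B then ∏ j, w (b (i.succAbove j)) else 0) ≤
        W * #B := by
      intro i _
      rw [sum_piFinset_succAbove i _ w
        (fun q => if ∏ j, q j ∈ B then ∏ j, w (q j) else 0)]
      refine mul_le_mul_of_nonneg_left ?_ hWpos.le
      have := sum_omegaPow_prod_mem_le 3 three_ne_zero (Ioc 0 N) B hB0
      push_cast at this
      exact this
    refine (sum_le_card_nsmul _ _ _ this).trans_eq ?_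
    simp
  refine le_of_mul_le_mul_left (a := W) ?_ hWpos
  linarith [key, hb1, hb2]

/-! ### Extremal sets and the comparison of the two maxima -/

theorem exists_card_eq_maxSizeP (k d n : ℕ) (hk : k ≠ 0) :
    ∃ A : Finset ℕ, A ⊆ Icc 1 n ∧ PropertyP k d (A : Set ℕ) ∧ #A = maxSizeP k d n := by
  classical
  have hne : ((Icc 1 n).powerset.filter
      (fun A : Finset ℕ => PropertyP k d (A : Set ℕ))).Nonempty := by
    refine ⟨∅, mem_filter.2 ⟨empty_mem_powerset _, ?_⟩⟩
    rintro ⟨a, x, ha, -⟩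
    simpa using ha ⟨0, Nat.pos_of_ne_zero hk⟩
  obtain ⟨A, hA, h⟩ := exists_mem_eq_sup _ hne Finset.card
  rw [mem_filter, mem_powerset] at hA
  refine ⟨A, hA.1, hA.2, ?_⟩
  rw [maxSizeP, ← h]

theorem card_le_maxSizeGamma {k d n : ℕ} {A : Finset ℕ} (hA : A ⊆ Icc 1 n)
    (hG : PropertyGamma k d (A : Set ℕ)) : #A ≤ maxSizeGamma k d n := by
  classical
  exact le_sup (f := Finset.card) (mem_filter.2 ⟨mem_powerset.2 hA, hG⟩)

/-- A multiset partitioned into blocks of size `d` has cardinality divisible by `d`. -/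
theorem not_isTrivialTuple {k d : ℕ} (hd : ¬ d ∣ k) (a : Fin k → ℕ) : ¬ IsTrivialTuple d a := by
  rintro ⟨P, hP, hsum⟩
  apply hd
  have h1 : Multiset.card P.sum = k := by rw [hsum]; simp
  rw [← h1, ← Multiset.join, Multiset.card_join]
  refine Multiset.dvd_sum fun x hx => ?_
  obtain ⟨T, hT, rfl⟩ := Multiset.mem_map.1 hx
  obtain ⟨b, rfl⟩ := hP T hT
  simp

theorem maxSizeGamma_le_maxSizeP {k d : ℕ} (hd : ¬ d ∣ k) (n : ℕ) :
    maxSizeGamma k d n ≤ maxSizeP k d n := by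
  classical
  refine Finset.sup_mono fun A hA => ?_
  rw [mem_filter] at hA ⊢
  refine ⟨hA.1, ?_⟩
  rintro ⟨a, x, ha, -, hx⟩
  exact not_isTrivialTuple hd a (hA.2 a x ha hx)

/-! ### The lower bound for the number of omitted integers -/

theorem exists_div_log_sq_le_sub_maxSizeP : ∃ c : ℝ, 0 < c ∧ ∃ n₀ : ℕ, ∀ n : ℕ, n₀ ≤ n →
    c * n / Real.log n ^ 2 ≤ (n : ℝ) - maxSizeP 4 3 n := by
  obtain ⟨c, hc, hW⟩ := exists_le_sum_omegaPow_third
  have hlim : Filter.Tendsto (fun x : ℝ => Real.log x ^ 2 / x) Filter.atTop (nhds 0) := by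
    have := (Real.isLittleO_pow_log_id_atTop (n := 2)).tendsto_div_nhds_zero
    simpa using this
  have hev := (hlim.comp tendsto_natCast_atTop_atTop).eventually
    (gt_mem_nhds (show (0 : ℝ) < c / 8 / 12 ^ 3 by positivity))
  obtain ⟨n₀, hn₀⟩ := Filter.eventually_atTop.1 hev
  refine ⟨c / 64, by positivity, max n₀ 8, fun n hn => ?_⟩
  have hn8 : 8 ≤ n := (le_max_right _ _).trans hn
  have hsmall := hn₀ n ((le_max_left _ _).trans hn)
  simp only [Function.comp_apply] at hsmall
  have hn0 : (0 : ℝ) < n := by positivity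
  have hlog : 0 < Real.log n := Real.log_pos (by exact_mod_cast (by omega : 1 < n))
  rw [div_lt_iff₀ hn0] at hsmall
  obtain ⟨A, hA, hP, hcard⟩ := exists_card_eq_maxSizeP 4 3 n (by norm_num)
  rw [← hcard]
  -- The integer cube root of `n`; rounding costs at most a factor 8.
  set N := Nat.findGreatest (fun N => N ^ 3 ≤ n) n with hNdef
  have hN3 : N ^ 3 ≤ n := Nat.findGreatest_spec (P := fun N => N ^ 3 ≤ n) (m := 0) (by omega)
    (by norm_num)
  have hN2 : 2 ≤ N := Nat.le_findGreatest (by omega) (by omega)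
  have hNn : N ≤ n := Nat.findGreatest_le n
  have hN8 : n ≤ 8 * N ^ 3 := by
    by_contra hcon
    have h1 : (N + 1) ^ 3 ≤ n := by
      have : (N + 1) ^ 3 ≤ (2 * N) ^ 3 := Nat.pow_le_pow_left (by omega) 3
      rw [mul_pow] at this
      omega
    have h2 : N + 1 ≤ n := (Nat.le_self_pow (by norm_num) _).trans h1
    exact absurd (Nat.le_findGreatest (P := fun N => N ^ 3 ≤ n) h2 h1) (by omega)
  have hN8' : (n : ℝ) ≤ 8 * (N : ℝ) ^ 3 := by exact_mod_cast hN8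
  have hlogN : 0 < Real.log N := Real.log_pos (by exact_mod_cast (by omega : 1 < N))
  have hlogle : Real.log N ≤ Real.log n :=
    Real.log_le_log (by positivity) (by exact_mod_cast hNn)
  set W := ∑ m ∈ Ioc 0 N, omegaPow (1 / 3) m with hWdef
  have hW0 : 0 ≤ W := sum_nonneg fun _ _ => omegaPow_nonneg (by norm_num) _
  have h1 : c * (n / 8) / Real.log n ^ 2 ≤ W ^ 3 := by
    refine le_trans ?_ (hW N hN2)
    gcongr
    linarith
  -- From `W ≥ 12` on, the diagonal term `6W²` is at most `W³/2`.
  have h2 : (12 : ℝ) ≤ W := by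
    by_contra hcon
    push Not at hcon
    have h3 : W ^ 3 < 12 ^ 3 := pow_lt_pow_left₀ hcon hW0 (by norm_num)
    have h4 : (12 : ℝ) ^ 3 < c * (n / 8) / Real.log n ^ 2 := by
      rw [lt_div_iff₀ (by positivity)]
      linarith
    linarith
  have h3 := omegaPow_sum_pow_le_card hN3 hA hP
  rw [← hWdef] at h3
  have h4 : 6 * W ^ 2 ≤ W ^ 3 / 2 := by nlinarith [sq_nonneg W]
  have h5 : c / 64 * n / Real.log n ^ 2 = c * (n / 8) / Real.log n ^ 2 / 8 := by ring
  rw [h5]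
  linarith

theorem exists_div_log_rpow_lt_sub_maxSizeP (ε : ℝ) (hε : 0 < ε) : ∃ n₀ : ℕ, ∀ n : ℕ, n₀ ≤ n →
    (n : ℝ) / Real.log n ^ (2 + ε) < (n : ℝ) - maxSizeP 4 3 n := by
  obtain ⟨c, hc, n₀, h⟩ := exists_div_log_sq_le_sub_maxSizeP
  have hlim : Filter.Tendsto (fun n : ℕ => Real.log n ^ ε) Filter.atTop Filter.atTop :=
    (tendsto_rpow_atTop hε).comp (Real.tendsto_log_atTop.comp tendsto_natCast_atTop_atTop)
  obtain ⟨n₁, h₁⟩ := Filter.eventually_atTop.1 (hlim.eventually_gt_atTop (1 / c))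
  refine ⟨max (max n₀ n₁) 2, fun n hn => ?_⟩
  have hn2 : 2 ≤ n := (le_max_right _ _).trans hn
  have hlog : 0 < Real.log n := Real.log_pos (by exact_mod_cast (by omega : 1 < n))
  refine lt_of_lt_of_le ?_ (h n (by omega))
  have h2 := h₁ n (by omega)
  rw [Real.rpow_add hlog, Real.rpow_two, div_lt_iff₀ (by positivity)]
  rw [div_lt_iff₀ hc] at h2
  have hn0 : (0 : ℝ) < n := by positivity
  have h3 : c * n / Real.log n ^ 2 * (Real.log n ^ 2 * Real.log n ^ ε) =
      n * (Real.log n ^ ε * c) := by field_simp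
  rw [h3]
  nlinarith

/-! ### The structure of solutions -/

/-- A solution of `a₀ a₁ a₂ a₃ = x ^ 3` in numbers with small square divisors comes, up to small
factors `u i`, from four numbers `b i` through `a i = ∏_{j ≠ i} b j`. -/
theorem exists_factorization_of_prod_eq_cube {a : Fin 4 → ℕ} {x T : ℕ} (hpos : ∀ i, a i ≠ 0)
    (hx : ∏ i, a i = x ^ 3) (hT : ∀ i d, d ^ 2 ∣ a i → d ≤ T) :
    ∃ b u : Fin 4 → ℕ, (∀ i, 0 < b i) ∧ (∀ i, 0 < u i ∧ u i ≤ T ^ 6) ∧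
      (∀ i, a i = u i * ∏ j, b (i.succAbove j)) ∧
      ∀ i : Fin 4, Squarefree (∏ j, b (i.succAbove j)) := by
  classical
  choose t s hst ht using fun i => Nat.sq_mul_squarefree (a i)
  have hs0 : ∀ i, s i ≠ 0 := fun i h => hpos i (by rw [← hst i, h]; simp)
  have ht0 : ∀ i, t i ≠ 0 := fun i h => hpos i (by rw [← hst i, h]; simp)
  have hsT : ∀ i, s i ≤ T := fun i => hT i _ ⟨t i, (hst i).symm⟩
  have hsp0 : ∏ i, s i ≠ 0 := prod_ne_zero_iff.2 fun i _ => hs0 i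
  -- Outside the primes of `D`, which divide some square part, every `a i` has exponent 0 or 1; `S
  -- i` collects its primes of exponent 1 there.
  set D := (∏ i, s i).primeFactors with hD
  set S : Fin 4 → Finset ℕ := fun i => (a i).primeFactors \ D with hS
  have hDprod : ∏ p ∈ D, p ≤ T ^ 4 :=
    calc ∏ p ∈ D, p ≤ ∏ i, s i :=
          Nat.le_of_dvd (Nat.pos_of_ne_zero hsp0) (Nat.prod_primeFactors_dvd _)
      _ ≤ ∏ _i : Fin 4, T := prod_le_prod' fun i _ => hsT i
      _ = T ^ 4 := by simp
  have hsD : ∀ i p, p.Prime → p ∉ D → ¬ p ∣ s i := fun i p hp hpD h =>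
    hpD (Nat.mem_primeFactors.2 ⟨hp, h.trans (dvd_prod_of_mem s (mem_univ i)), hsp0⟩)
  have hSprime : ∀ i p, p ∈ S i → p.Prime := fun i p hp =>
    Nat.prime_of_mem_primeFactors (mem_sdiff.1 hp).1
  have hSt : ∀ i, S i ⊆ (t i).primeFactors := by
    intro i p hp
    have hpp := hSprime i p hp
    rw [hS, mem_sdiff] at hp
    have hdvd := Nat.dvd_of_mem_primeFactors hp.1
    rw [← hst i] at hdvd
    rcases hpp.dvd_mul.1 hdvd with h | h
    · exact absurd (hpp.dvd_of_dvd_pow h) (hsD i p hpp hp.2)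
    · exact Nat.mem_primeFactors.2 ⟨hpp, h, ht0 i⟩
  have htS : ∀ i, (t i).primeFactors ⊆ S i ∪ D := by
    intro i p hp
    by_cases hpD : p ∈ D
    · exact mem_union_right _ hpD
    · refine mem_union_left _ (mem_sdiff.2 ⟨?_, hpD⟩)
      exact Nat.primeFactors_mono ⟨s i ^ 2, by rw [← hst i]; ring⟩ (hpos i) hp
  have hfac : ∀ i p, p.Prime → p ∉ D → (a i).factorization p = if p ∈ S i then 1 else 0 := by
    intro i p hp hpD
    have h1 : (a i).factorization p = (t i).factorization p := by
      rw [← hst i, Nat.factorization_mul (pow_ne_zero 2 (hs0 i)) (ht0 i), Nat.factorization_pow]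
      simp [Nat.factorization_eq_zero_of_not_dvd (hsD i p hp hpD)]
    have h2 : (t i).factorization p ≤ 1 := (ht i).natFactorization_le_one p
    split_ifs with h
    · have h3 := hp.factorization_pos_of_dvd (ht0 i) (Nat.dvd_of_mem_primeFactors (hSt i h))
      omega
    · by_contra hne
      apply h
      refine mem_sdiff.2 ⟨?_, hpD⟩
      rw [← Nat.support_factorization, Finsupp.mem_support_iff]
      exact hne
  set U := univ.biUnion S with hU
  -- The count is a multiple of 3 because the product is a cube, and lies between 1 and 4. So each
  -- prime of `U` misses exactly one index.
  have hcount : ∀ p ∈ U, #{i | p ∈ S i} = 3 := by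
    intro p hp
    obtain ⟨i, -, hi⟩ := mem_biUnion.1 hp
    have hpp := hSprime i p hi
    have hpD : p ∉ D := (mem_sdiff.1 hi).2
    have h1 : ∑ i, (a i).factorization p = 3 * x.factorization p := by
      have := congrArg (fun m => m.factorization p) hx
      simp only [Nat.factorization_pow, Nat.factorization_prod fun i _ => hpos i] at this
      simpa using this
    rw [sum_congr rfl fun i _ => hfac i p hpp hpD, sum_boole] at h1
    have h2 : 0 < #{i | p ∈ S i} := card_pos.2 ⟨i, by simpa using hi⟩
    have h3 : #{i | p ∈ S i} ≤ 4 := (card_le_univ _).trans_eq (by simp)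
    simp only [Nat.cast_id] at h1
    omega
  have hmiss : ∀ p ∈ U, ∀ i j, p ∉ S i → p ∉ S j → i = j := by
    intro p hp i j hi hj
    by_contra hij
    have h1 := hcount p hp
    have h2 : ({k | p ∈ S k} : Finset (Fin 4)) ⊆ univ \ {i, j} := by
      intro k hk
      have hk' : p ∈ S k := by simpa using hk
      simp only [mem_sdiff, mem_univ, true_and, mem_insert, mem_singleton, not_or]
      exact ⟨fun h => hi (h ▸ hk'), fun h => hj (h ▸ hk')⟩
    have h3 := card_le_card h2
    rw [card_sdiff_of_subset (subset_univ _), card_pair hij] at h3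
    simp at h3
    omega
  have hSU : ∀ i, S i = univ.biUnion fun j : Fin 3 => U \ S (i.succAbove j) := by
    intro i
    ext p
    simp only [mem_biUnion, mem_univ, true_and, mem_sdiff]
    constructor
    · intro hp
      have hpU : p ∈ U := mem_biUnion.2 ⟨i, mem_univ i, hp⟩
      by_contra hcon
      push Not at hcon
      have h1 : ({k | p ∈ S k} : Finset (Fin 4)) = univ := by
        ext k
        simp only [mem_filter, mem_univ, true_and, iff_true]
        exact Fin.succAboveCases (α := fun k => p ∈ S k) i hp (fun j => hcon j hpU) k
      have := hcount p hpU
      rw [h1] at this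
      simp at this
    · rintro ⟨j, hpU, hj⟩
      by_contra hi
      exact Fin.succAbove_ne i j (hmiss p hpU _ _ hj hi)
  -- `b i` gathers the primes missing from `a i`; each of them divides the other three.
  set b : Fin 4 → ℕ := fun i => ∏ p ∈ U \ S i, p with hb
  have hbS : ∀ i, ∏ j, b (i.succAbove j) = ∏ p ∈ S i, p := by
    intro i
    conv_rhs => rw [hSU i]
    rw [prod_biUnion]
    intro j _ k _ hjk
    rw [Function.onFun, disjoint_left]
    intro p hp hq
    rw [mem_sdiff] at hp hq
    exact hjk (Fin.succAbove_right_injective (hmiss p hp.1 _ _ hp.2 hq.2))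
  have hSdvd : ∀ i, ∏ p ∈ S i, p ∣ t i := fun i =>
    (prod_dvd_prod_of_subset _ _ _ (hSt i)).trans (Nat.prod_primeFactors_dvd _)
  have hSdvd' : ∀ i, ∏ p ∈ S i, p ∣ a i := fun i =>
    (hSdvd i).trans ⟨s i ^ 2, by rw [← hst i]; ring⟩
  have hSpos : ∀ i, 0 < ∏ p ∈ S i, p := fun i => prod_pos fun p hp => (hSprime i p hp).pos
  refine ⟨b, fun i => a i / ∏ p ∈ S i, p, fun i => ?_, fun i => ⟨?_, ?_⟩, fun i => ?_, fun i => ?_⟩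
  · refine prod_pos fun p hp => ?_
    obtain ⟨j, -, hj⟩ := mem_biUnion.1 (mem_sdiff.1 hp).1
    exact (hSprime j p hj).pos
  · exact Nat.div_pos (Nat.le_of_dvd (Nat.pos_of_ne_zero (hpos i)) (hSdvd' i)) (hSpos i)
  · have h1 : t i ≤ (∏ p ∈ S i, p) * T ^ 4 :=
      calc t i = ∏ p ∈ (t i).primeFactors, p := (Nat.prod_primeFactors_of_squarefree (ht i)).symm
        _ ≤ ∏ p ∈ S i ∪ D, p := by
            refine prod_le_prod_of_subset_of_one_le' (htS i) fun p hp _ => ?_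
            rcases mem_union.1 hp with h | h
            · exact (hSprime i p h).one_le
            · exact (Nat.prime_of_mem_primeFactors h).one_le
        _ = (∏ p ∈ S i, p) * ∏ p ∈ D, p := prod_union sdiff_disjoint
        _ ≤ _ := Nat.mul_le_mul_left _ hDprod
    refine Nat.div_le_of_le_mul ?_
    calc a i = s i ^ 2 * t i := (hst i).symm
      _ ≤ T ^ 2 * ((∏ p ∈ S i, p) * T ^ 4) := Nat.mul_le_mul (Nat.pow_le_pow_left (hsT i) 2) h1
      _ = (∏ p ∈ S i, p) * T ^ 6 := by ring
  · rw [hbS i, Nat.div_mul_cancel (hSdvd' i)]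
  · rw [hbS i]
    exact (ht i).squarefree_of_dvd (hSdvd i)

/-- Since `aᵢ bᵢ = uᵢ ∏ bⱼ`, the `bᵢ` differ by a factor at most `T · T⁶ = T⁷`. Comparing `b³` with
the product of three of them gives `T²¹`; the factors `u` and `n/a` raise this to `T²⁸` on the other
side. -/
theorem exists_balanced_factorization {a : Fin 4 → ℕ} {x T n : ℕ} (hpos : ∀ i, a i ≠ 0)
    (hx : ∏ i, a i = x ^ 3) (hT : ∀ i d, d ^ 2 ∣ a i → d ≤ T) (han : ∀ i, a i ≤ n)
    (hna : ∀ i, n ≤ a i * T) :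
    ∃ (u : ℕ) (b : Fin 3 → ℕ), 0 < u ∧ u ≤ T ^ 6 ∧ a 0 = u * ∏ j, b j ∧ Squarefree (∏ j, b j) ∧
      ∀ j, n ≤ T ^ 28 * b j ^ 3 ∧ b j ^ 3 ≤ T ^ 21 * n := by
  obtain ⟨b, u, hb, hu, hab, hsq⟩ := exists_factorization_of_prod_eq_cube hpos hx hT
  refine ⟨u 0, fun j => b (Fin.succAbove 0 j), (hu 0).1, (hu 0).2, hab 0, hsq 0, ?_⟩
  have hcmp : ∀ i j, b i ≤ T ^ 7 * b j := by
    intro i j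
    have hB : ∀ k, a k * b k = u k * ∏ l, b l := by
      intro k
      rw [hab k, Fin.prod_univ_succAbove b k]
      ring
    refine Nat.le_of_mul_le_mul_left ?_ (Nat.pos_of_ne_zero (hpos i))
    calc a i * b i ≤ a i * b i * u j := Nat.le_mul_of_pos_right _ (hu j).1
      _ = a j * b j * u i := by rw [hB i, hB j]; ring
      _ ≤ (a i * T) * b j * T ^ 6 :=
          Nat.mul_le_mul (Nat.mul_le_mul_right _ ((han j).trans (hna i))) (hu i).2
      _ = a i * (T ^ 7 * b j) := by ring
  intro j
  simp only
  set k := Fin.succAbove 0 j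
  constructor
  · calc n ≤ a 0 * T := hna 0
      _ = u 0 * (∏ j, b (Fin.succAbove 0 j)) * T := by rw [← hab 0]
      _ ≤ T ^ 6 * (∏ _j : Fin 3, (T ^ 7 * b k)) * T :=
          Nat.mul_le_mul_right _ (Nat.mul_le_mul (hu 0).2 (prod_le_prod' fun _ _ => hcmp _ _))
      _ = T ^ 28 * b k ^ 3 := by simp; ring
  · calc b k ^ 3 = ∏ _j : Fin 3, b k := by simp
      _ ≤ ∏ j, (T ^ 7 * b (Fin.succAbove 0 j)) := prod_le_prod' fun _ _ => hcmp _ _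
      _ = T ^ 21 * ∏ j, b (Fin.succAbove 0 j) := by rw [prod_mul_distrib, prod_const, card_univ, Fintype.card_fin, ← pow_mul]
      _ ≤ T ^ 21 * a 0 := by
          refine Nat.mul_le_mul_left _ ?_
          conv_rhs => rw [hab 0]
          exact Nat.le_mul_of_pos_left _ (hu 0).1
      _ ≤ T ^ 21 * n := Nat.mul_le_mul_left _ (han 0)

/-! ### Counting numbers with a balanced factorization -/

theorem exists_sum_omegaPow_div_Ico_le : ∃ C : ℝ, 0 < C ∧ ∀ M : ℕ, 2 ≤ M → ∀ J : ℕ,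
    ∑ b ∈ Ico M (2 ^ J * M), omegaPow (1 / 2) b / b ≤ J * C / √(Real.log M) := by
  obtain ⟨C, hC, hS⟩ := exists_sum_omegaPow_half_le
  refine ⟨2 * C, by positivity, fun M hM J => ?_⟩
  have hlog : 0 < Real.log M := Real.log_pos (by exact_mod_cast hM)
  have hw0 : ∀ n, 0 ≤ omegaPow (1 / 2) n := omegaPow_nonneg (by norm_num)
  induction J with
  | zero => simp
  | succ J ih =>
    have h1 : M ≤ 2 ^ J * M := Nat.le_mul_of_pos_left _ (by positivity)
    have h2 : 2 ^ J * M ≤ 2 ^ (J + 1) * M := by gcongr <;> omega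
    rw [← sum_Ico_consecutive _ h1 h2]
    have hK0 : (0 : ℝ) < (2 ^ J * M : ℕ) := by
      have : 0 < 2 ^ J * M := by omega
      exact_mod_cast this
    have h3 : ∑ b ∈ Ico (2 ^ J * M) (2 ^ (J + 1) * M), omegaPow (1 / 2) b / b ≤
        2 * C / √(Real.log M) := by
      calc ∑ b ∈ Ico (2 ^ J * M) (2 ^ (J + 1) * M), omegaPow (1 / 2) b / b
          ≤ ∑ b ∈ Ico (2 ^ J * M) (2 ^ (J + 1) * M), omegaPow (1 / 2) b / (2 ^ J * M : ℕ) := by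
            refine sum_le_sum fun b hb => ?_
            have := (mem_Ico.1 hb).1
            exact div_le_div_of_nonneg_left (hw0 b) hK0 (by exact_mod_cast this)
        _ = (∑ b ∈ Ico (2 ^ J * M) (2 ^ (J + 1) * M), omegaPow (1 / 2) b) / (2 ^ J * M : ℕ) :=
            (sum_div _ _ _).symm
        _ ≤ (∑ b ∈ Ioc 0 (2 ^ (J + 1) * M), omegaPow (1 / 2) b) / (2 ^ J * M : ℕ) := by
            refine div_le_div_of_nonneg_right ?_ hK0.le
            refine sum_le_sum_of_subset_of_nonneg (fun b hb => ?_) fun _ _ _ => hw0 _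
            rw [mem_Ico] at hb
            exact mem_Ioc.2 ⟨by omega, hb.2.le⟩
        _ ≤ (C * (2 ^ (J + 1) * M : ℕ) / √(Real.log M)) / (2 ^ J * M : ℕ) := by
            refine div_le_div_of_nonneg_right ((hS _ (by omega)).trans ?_) hK0.le
            refine div_le_div_of_nonneg_left (by positivity) (Real.sqrt_pos.2 hlog) ?_
            refine Real.sqrt_le_sqrt (Real.log_le_log (by positivity) ?_)
            exact_mod_cast h1.trans h2
        _ = 2 * C / √(Real.log M) := by
            have : ((2 ^ (J + 1) * M : ℕ) : ℝ) = 2 * (2 ^ J * M : ℕ) := by push_cast; ring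
            rw [this]
            field_simp
    calc _ ≤ J * (2 * C) / √(Real.log M) + 2 * C / √(Real.log M) := add_le_add ih h3
      _ = _ := by push_cast; ring

/-- For squarefree `P`, `2^Ω(P) = τ(P) ≤ τ(a)`. This lets numbers with few divisors be counted with
the weight `2^(-Ω)`. -/
theorem one_le_mul_omegaPow_half {P a : ℕ} {Y : ℝ} (hP : Squarefree P) (hPa : P ∣ a)
    (ha : a ≠ 0) (hY : (#a.divisors : ℝ) ≤ Y) : 1 ≤ Y * omegaPow (1 / 2) P := by
  have hP0 : P ≠ 0 := hP.ne_zero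
  have h1 : #P.divisors = 2 ^ cardFactors P := by
    rw [Nat.card_divisors hP0, ← (cardDistinctFactors_eq_cardFactors_iff_squarefree hP0).2 hP,
      cardDistinctFactors_apply, ← List.card_toFinset]
    change _ = 2 ^ #P.primeFactors
    rw [← prod_const]
    refine prod_congr rfl fun p hp => ?_
    rw [Nat.factorization_eq_one_of_squarefree hP (Nat.prime_of_mem_primeFactors hp)
      (Nat.dvd_of_mem_primeFactors hp)]
  have h2 : (2 : ℝ) ^ cardFactors P ≤ Y := by
    refine le_trans ?_ hY
    have := card_le_card (Nat.divisors_subset_of_dvd ha hPa)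
    rw [h1] at this
    exact_mod_cast this
  rw [omegaPow_apply _ hP0]
  calc (1 : ℝ) = 2 ^ cardFactors P * (1 / 2) ^ cardFactors P := by
        rw [← mul_pow]; norm_num
    _ ≤ _ := by gcongr

/-- Sum the weights over `(v, x, y, z)` with `vxyz ≤ n`. The sum over `z` gives `n/(vxy√log M)`; the
remaining reciprocal sums give `1 + log V` from `v` and `J/√log M` from each of `x` and `y`. -/
theorem exists_card_balanced_le : ∃ C : ℝ, 0 < C ∧ ∀ (n M J V : ℕ) (Y : ℝ) (B : Finset ℕ),
    2 ≤ M → 0 ≤ Y →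
    (∀ a ∈ B, 0 < a ∧ a ≤ n ∧ (#a.divisors : ℝ) ≤ Y ∧ ∃ (u : ℕ) (b : Fin 3 → ℕ), 0 < u ∧ u ≤ V ∧
      a = u * ∏ j, b j ∧ Squarefree (∏ j, b j) ∧ ∀ j, b j ∈ Ico M (2 ^ J * M)) →
    (#B : ℝ) ≤ C * Y * n * J ^ 2 * (1 + Real.log V) / √(Real.log M) ^ 3 := by
  obtain ⟨C₀, hC₀, hS⟩ := exists_sum_omegaPow_half_le
  obtain ⟨C₁, hC₁, hI⟩ := exists_sum_omegaPow_div_Ico_le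
  refine ⟨C₀ * C₁ ^ 2, by positivity, fun n M J V Y B hM hY hB => ?_⟩
  have hlog : 0 < Real.log M := Real.log_pos (by exact_mod_cast hM)
  have hsq : 0 < √(Real.log M) := Real.sqrt_pos.2 hlog
  set w := omegaPow (1 / 2) with hw
  have hw0 : ∀ n, 0 ≤ w n := omegaPow_nonneg (by norm_num)
  set R := Ico M (2 ^ J * M) with hR
  choose! u b hu0 huV hab hbsq hbR using fun a ha => (hB a ha).2.2.2
  set I := ((Ioc 0 V) ×ˢ R ×ˢ R ×ˢ R).filter (fun q => q.1 * (q.2.1 * q.2.2.1 * q.2.2.2) ≤ n)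
    with hI'
  set φ : ℕ → ℕ × ℕ × ℕ × ℕ := fun a => (u a, b a 0, b a 1, b a 2) with hφ
  have hφval : ∀ a ∈ B, a = (φ a).1 * ((φ a).2.1 * (φ a).2.2.1 * (φ a).2.2.2) := by
    intro a ha
    conv_lhs => rw [hab a ha, Fin.prod_univ_three]
  have hφinj : Set.InjOn φ B := by
    intro a ha a' ha' h
    rw [hφval a ha, hφval a' ha', h]
  have hinner : ∀ v ∈ Ioc 0 V, ∀ x ∈ R, ∀ y ∈ R,
      ∑ z ∈ R with v * (x * y * z) ≤ n, w z ≤ C₀ * (n / (v * x * y)) / √(Real.log M) := by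
    intro v hv x hx y hy
    have hvxy : 0 < v * (x * y) := by
      have h1 := (mem_Ioc.1 hv).1
      have h2 := (mem_Ico.1 hx).1
      have h3 := (mem_Ico.1 hy).1
      have : 0 < x := by omega
      have : 0 < y := by omega
      positivity
    set X := n / (v * (x * y)) with hX
    have hXle : (X : ℝ) ≤ n / (v * x * y) := by
      calc (X : ℝ) ≤ n / ((v * (x * y) : ℕ) : ℝ) := Nat.cast_div_le
        _ = _ := by push_cast; rw [mul_assoc]
    have hz : ∀ z, v * (x * y * z) ≤ n ↔ z ≤ X := by
      intro z
      rw [hX, Nat.le_div_iff_mul_le hvxy]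
      have : z * (v * (x * y)) = v * (x * y * z) := by ring
      rw [this]
    -- If `X < M` no `z` is admissible; otherwise `log X` may be replaced by `log M`.
    rcases lt_or_ge X M with hlt | hge
    · rw [filter_eq_empty_iff.2, sum_empty]
      · positivity
      · intro z hzR hzn
        have := (mem_Ico.1 hzR).1
        have := (hz z).1 hzn
        omega
    · calc ∑ z ∈ R with v * (x * y * z) ≤ n, w z ≤ ∑ z ∈ Ioc 0 X, w z := by
            refine sum_le_sum_of_subset_of_nonneg (fun z hzR => ?_) fun _ _ _ => hw0 _
            rw [mem_filter, mem_Ico] at hzR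
            exact mem_Ioc.2 ⟨by omega, (hz z).1 hzR.2⟩
        _ ≤ C₀ * X / √(Real.log X) := hS X (hM.trans hge)
        _ ≤ C₀ * X / √(Real.log M) := by
            refine div_le_div_of_nonneg_left (by positivity) hsq (Real.sqrt_le_sqrt ?_)
            exact Real.log_le_log (by positivity) (by exact_mod_cast hge)
        _ ≤ _ := by gcongr
  have hrange := hI M hM J
  have hrange0 : 0 ≤ ∑ b ∈ R, w b / b := sum_nonneg fun _ _ => div_nonneg (hw0 _) (by positivity)
  calc (#B : ℝ) = ∑ _a ∈ B, (1 : ℝ) := by simp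
    _ ≤ ∑ a ∈ B, Y * (w (φ a).2.1 * w (φ a).2.2.1 * w (φ a).2.2.2) := by
        refine sum_le_sum fun a ha => ?_
        rw [hw, ← omegaPow_mul, ← omegaPow_mul]
        have h1 := hbsq a ha
        rw [Fin.prod_univ_three] at h1
        exact one_le_mul_omegaPow_half h1 ⟨u a, by rw [mul_comm]; exact hφval a ha⟩
          (hB a ha).1.ne' (hB a ha).2.2.1
    _ = ∑ q ∈ B.image φ, Y * (w q.2.1 * w q.2.2.1 * w q.2.2.2) := by
        rw [sum_image hφinj]
    _ ≤ ∑ q ∈ I, Y * (w q.2.1 * w q.2.2.1 * w q.2.2.2) := by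
        refine sum_le_sum_of_subset_of_nonneg ?_ fun q _ _ =>
          mul_nonneg hY (mul_nonneg (mul_nonneg (hw0 _) (hw0 _)) (hw0 _))
        intro q hq
        obtain ⟨a, ha, rfl⟩ := mem_image.1 hq
        rw [hI', mem_filter, ← hφval a ha]
        simp only [mem_product]
        exact ⟨⟨mem_Ioc.2 ⟨hu0 a ha, huV a ha⟩, hbR a ha 0, hbR a ha 1, hbR a ha 2⟩, (hB a ha).2.1⟩
    _ = Y * ∑ v ∈ Ioc 0 V, ∑ x ∈ R, ∑ y ∈ R, w x * w y *
          ∑ z ∈ R with v * (x * y * z) ≤ n, w z := by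
        rw [← mul_sum, hI', sum_filter]
        simp only [sum_product, sum_filter, mul_sum, mul_ite, mul_zero]
    _ ≤ Y * ∑ v ∈ Ioc 0 V, ∑ x ∈ R, ∑ y ∈ R, w x * w y *
          (C₀ * (n / (v * x * y)) / √(Real.log M)) := by
        refine mul_le_mul_of_nonneg_left (sum_le_sum fun v hv => sum_le_sum fun x hx =>
          sum_le_sum fun y hy => ?_) hY
        exact mul_le_mul_of_nonneg_left (hinner v hv x hx y hy) (mul_nonneg (hw0 _) (hw0 _))
    _ = Y * (C₀ * n / √(Real.log M)) * ((∑ v ∈ Ioc 0 V, (1 : ℝ) / v) * (∑ b ∈ R, w b / b) *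
          (∑ b ∈ R, w b / b)) := by
        rw [mul_assoc Y, mul_assoc (∑ v ∈ Ioc 0 V, (1 : ℝ) / v), sum_mul_sum R R, sum_mul]
        congr 1
        rw [mul_sum]
        refine sum_congr rfl fun v _ => ?_
        rw [mul_sum, mul_sum]
        refine sum_congr rfl fun x _ => ?_
        rw [mul_sum, mul_sum]
        refine sum_congr rfl fun y _ => ?_
        simp only [div_eq_mul_inv, mul_inv, one_mul]
        ring
    _ ≤ Y * (C₀ * n / √(Real.log M)) * ((1 + Real.log V) * (J * C₁ / √(Real.log M)) *
          (J * C₁ / √(Real.log M))) := by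
        have h1 := sum_Ioc_one_div_le V
        have h2 : 0 ≤ 1 + Real.log V := add_nonneg zero_le_one (Real.log_natCast_nonneg V)
        gcongr
    _ = _ := by field_simp

/-! ### Exceptional sets and the upper bound with free parameters -/

theorem card_filter_mul_lt_le (n : ℕ) {T : ℕ} (hT : T ≠ 0) :
    (#{a ∈ Icc 1 n | a * T < n} : ℝ) ≤ n / T := by
  have hsub : {a ∈ Icc 1 n | a * T < n} ⊆ Ioc 0 (n / T) := by
    intro a ha
    rw [mem_filter, mem_Icc] at ha
    exact mem_Ioc.2 ⟨ha.1.1, (Nat.le_div_iff_mul_le (Nat.pos_of_ne_zero hT)).2 ha.2.le⟩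
  have := card_le_card hsub
  rw [Nat.card_Ioc, Nat.sub_zero] at this
  exact (Nat.cast_le.2 this).trans Nat.cast_div_le

open Classical in
theorem card_filter_sq_dvd_le (n : ℕ) {T : ℕ} (hT : T ≠ 0) :
    (#{a ∈ Icc 1 n | ∃ d, d ^ 2 ∣ a ∧ T < d} : ℝ) ≤ n / T := by
  have hsub : {a ∈ Icc 1 n | ∃ d, d ^ 2 ∣ a ∧ T < d} ⊆
      (Ioc T n).biUnion fun d => {a ∈ Ioc 0 n | d ^ 2 ∣ a} := by
    intro a ha
    rw [mem_filter, mem_Icc] at ha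
    obtain ⟨⟨h1, h2⟩, d, hd, hTd⟩ := ha
    have hda : d ≤ a := (Nat.le_self_pow two_ne_zero d).trans (Nat.le_of_dvd h1 hd)
    exact mem_biUnion.2 ⟨d, mem_Ioc.2 ⟨hTd, hda.trans h2⟩,
      mem_filter.2 ⟨mem_Ioc.2 ⟨h1, h2⟩, hd⟩⟩
  have h1 := (card_le_card hsub).trans card_biUnion_le
  simp only [Nat.Ioc_filter_dvd_card_eq_div] at h1
  calc (#{a ∈ Icc 1 n | ∃ d, d ^ 2 ∣ a ∧ T < d} : ℝ)
      ≤ ((∑ d ∈ Ioc T n, n / d ^ 2 : ℕ) : ℝ) := by exact_mod_cast h1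
    _ ≤ ∑ d ∈ Ioc T n, n * (1 / (d : ℝ) ^ 2) := by
        rw [Nat.cast_sum]
        refine sum_le_sum fun d _ => ?_
        rw [mul_one_div]
        exact_mod_cast Nat.cast_div_le (α := ℝ) (m := n) (n := d ^ 2)
    _ ≤ n * (1 / T) := by
        rw [← mul_sum]
        exact mul_le_mul_of_nonneg_left (sum_Ioc_one_div_sq_le T n hT) (by positivity)
    _ = n / T := by ring

/-- Markov's inequality with `∑ τ(a) = ∑ ⌊n/a⌋`. -/
theorem card_filter_lt_card_divisors_le (n : ℕ) {Y : ℝ} (hY : 0 < Y) :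
    (#{a ∈ Icc 1 n | Y < #a.divisors} : ℝ) ≤ n * (1 + Real.log n) / Y := by
  rw [le_div_iff₀ hY]
  calc (#{a ∈ Icc 1 n | Y < #a.divisors} : ℝ) * Y
      = ∑ a ∈ Icc 1 n with Y < #a.divisors, Y := by rw [sum_const, nsmul_eq_mul]
    _ ≤ ∑ a ∈ Icc 1 n with Y < #a.divisors, (#a.divisors : ℝ) :=
        sum_le_sum fun a ha => (mem_filter.1 ha).2.le
    _ ≤ ∑ a ∈ Icc 1 n, (#a.divisors : ℝ) :=
        sum_le_sum_of_subset_of_nonneg (filter_subset _ _) fun _ _ _ => by positivity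
    _ = ((∑ a ∈ Ioc 0 n, n / a : ℕ) : ℝ) := by
        rw [← sum_Ioc_sigma0_eq_sum_div]
        simp only [sigma_zero_apply, Nat.cast_sum]
        rfl
    _ ≤ ∑ a ∈ Ioc 0 n, n * (1 / (a : ℝ)) := by
        rw [Nat.cast_sum]
        refine sum_le_sum fun a _ => ?_
        rw [mul_one_div]
        exact Nat.cast_div_le
    _ ≤ _ := by
        rw [← mul_sum]
        exact mul_le_mul_of_nonneg_left (sum_Ioc_one_div_le n) (by positivity)

theorem exists_sub_maxSizeGamma_le : ∃ C : ℝ, 0 < C ∧ ∀ (n M J T : ℕ) (Y : ℝ), T ≠ 0 → 2 ≤ M →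
    0 < Y → (∀ b : ℕ, n ≤ T ^ 28 * b ^ 3 → b ^ 3 ≤ T ^ 21 * n → b ∈ Ico M (2 ^ J * M)) →
    (n : ℝ) - maxSizeGamma 4 3 n ≤ 2 * (n / T) + n * (1 + Real.log n) / Y +
      C * Y * n * J ^ 2 * (1 + 6 * Real.log T) / √(Real.log M) ^ 3 := by
  classical
  obtain ⟨C, hC, hbal⟩ := exists_card_balanced_le
  refine ⟨C, hC, fun n M J T Y hT hM hY hR => ?_⟩
  set bal : ℕ → Prop := fun a => ∃ (u : ℕ) (b : Fin 3 → ℕ), 0 < u ∧ u ≤ T ^ 6 ∧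
    a = u * ∏ j, b j ∧ Squarefree (∏ j, b j) ∧ ∀ j, b j ∈ Ico M (2 ^ J * M) with hbaldef
  set B₁ := {a ∈ Icc 1 n | a * T < n} with hB₁
  set B₂ := {a ∈ Icc 1 n | ∃ d, d ^ 2 ∣ a ∧ T < d} with hB₂
  set B₃ := {a ∈ Icc 1 n | Y < #a.divisors} with hB₃
  set B₄ := {a ∈ Icc 1 n | (#a.divisors : ℝ) ≤ Y ∧ bal a} with hB₄
  set A := Icc 1 n \ (B₁ ∪ B₂ ∪ B₃ ∪ B₄) with hA
  have hAG : PropertyGamma 4 3 (A : Set ℕ) := by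
    intro a x ha hx
    exfalso
    have hmem : ∀ i, a i ∈ Icc 1 n ∧ a i ∉ B₁ ∧ a i ∉ B₂ ∧ a i ∉ B₃ ∧ a i ∉ B₄ := by
      intro i
      have h := ha i
      rw [mem_coe, hA, mem_sdiff] at h
      simp only [mem_union, not_or] at h
      exact ⟨h.1, h.2.1.1.1, h.2.1.1.2, h.2.1.2, h.2.2⟩
    have hin : ∀ i, 1 ≤ a i ∧ a i ≤ n := fun i => mem_Icc.1 (hmem i).1
    have hx' : ∏ i, a i = x.natAbs ^ 3 := by
      have := congrArg Int.natAbs hx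
      rw [Int.natAbs_pow, ← Nat.cast_prod, Int.natAbs_natCast] at this
      exact this
    obtain ⟨u, b, hu, huT, hab, hsq, hb⟩ := exists_balanced_factorization (T := T) (n := n)
      (fun i => by have := (hin i).1; omega) hx'
      (fun i d hd => by
        by_contra hcon
        exact (hmem i).2.2.1 (mem_filter.2 ⟨(hmem i).1, d, hd, by omega⟩))
      (fun i => (hin i).2)
      (fun i => by
        by_contra hcon
        exact (hmem i).2.1 (mem_filter.2 ⟨(hmem i).1, by omega⟩))
    have h3 : (#(a 0).divisors : ℝ) ≤ Y := by
      by_contra hcon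
      exact (hmem 0).2.2.2.1 (mem_filter.2 ⟨(hmem 0).1, by linarith⟩)
    exact (hmem 0).2.2.2.2 (mem_filter.2 ⟨(hmem 0).1, h3, u, b, hu, huT, hab, hsq,
      fun j => hR _ (hb j).1 (hb j).2⟩)
  have h1 := card_filter_mul_lt_le n hT
  have h2 := card_filter_sq_dvd_le n hT
  have h3 := card_filter_lt_card_divisors_le n hY
  have h4 := hbal n M J (T ^ 6) Y B₄ hM hY.le (fun a ha => by
    rw [hB₄, mem_filter, mem_Icc] at ha
    exact ⟨ha.1.1, ha.1.2, ha.2.1, ha.2.2⟩)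
  rw [Nat.cast_pow, Real.log_pow] at h4
  push_cast at h4
  rw [← hB₁] at h1
  rw [← hB₃] at h3
  have hcard : (n : ℝ) ≤ #A + (#B₁ + #B₂ + #B₃ + #B₄) := by
    have h5 : #(Icc 1 n) ≤ #(A ∪ (B₁ ∪ B₂ ∪ B₃ ∪ B₄)) := card_le_card (by
      intro a ha
      rw [mem_union, hA, mem_sdiff]
      tauto)
    have h6 := card_union_le A (B₁ ∪ B₂ ∪ B₃ ∪ B₄)
    have h7 := card_union_le (B₁ ∪ B₂ ∪ B₃) B₄
    have h8 := card_union_le (B₁ ∪ B₂) B₃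
    have h9 := card_union_le B₁ B₂
    rw [Nat.card_Icc] at h5
    have h10 : n ≤ #A + (#B₁ + #B₂ + #B₃ + #B₄) := by omega
    exact_mod_cast h10
  have hAle : (#A : ℝ) ≤ maxSizeGamma 4 3 n := by
    exact_mod_cast card_le_maxSizeGamma sdiff_subset hAG
  have h2' : (#B₂ : ℝ) ≤ n / T := by
    rw [hB₂]; convert h2
  linarith

/-! ### Choice of the parameters -/

theorem exists_sub_maxSizeGamma_le_log : ∃ C : ℝ, 0 < C ∧ ∃ n₀ : ℕ, ∀ n : ℕ, n₀ ≤ n →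
    (n : ℝ) - maxSizeGamma 4 3 n ≤
      n * ((4 + C * Real.log (Real.log n) ^ 3) / Real.log n ^ (1 / 4 : ℝ)) := by
  obtain ⟨C, hC, hmain⟩ := exists_sub_maxSizeGamma_le
  have hL : Filter.Tendsto (fun n : ℕ => Real.log n) Filter.atTop Filter.atTop :=
    Real.tendsto_log_atTop.comp tendsto_natCast_atTop_atTop
  have hev1 := (Real.tendsto_log_atTop.comp hL).eventually_ge_atTop 1
  -- With `log T ≤ 2 log log n`, the term `28 log T` is at most `56/224 = 1/4` of `log n`, leaving
  -- `log M ≥ (log n)/4`.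
  have hev2 := hL.eventually (Real.isLittleO_log_id_atTop.def (show (0 : ℝ) < 1 / 224 by norm_num))
  obtain ⟨n₀, hn₀⟩ := Filter.eventually_atTop.1 (hev1.and hev2)
  refine ⟨C * (8 * 85 ^ 2 * 13), by positivity, max n₀ 3, fun n hn => ?_⟩
  obtain ⟨hl1, hl2⟩ := hn₀ n ((le_max_left _ _).trans hn)
  have hn3 : 3 ≤ n := (le_max_right _ _).trans hn
  simp only [Function.comp_apply, id] at hl1 hl2
  set x := Real.log n with hx
  set l := Real.log x with hl
  have hn0 : (0 : ℝ) < n := by positivity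
  have hx0 : 0 < x := Real.log_pos (by exact_mod_cast (by omega : 1 < n))
  rw [Real.norm_of_nonneg (by linarith), Real.norm_of_nonneg hx0.le] at hl2
  have hx1 : 224 ≤ x := by linarith
  set T := ⌈x⌉₊ with hT
  have hTx : x ≤ T := Nat.le_ceil x
  have hT0 : T ≠ 0 := (Nat.ceil_pos.2 hx0).ne'
  have hT2x : (T : ℝ) ≤ 2 * x := by linarith [Nat.ceil_lt_add_one hx0.le]
  clear_value T
  have hTpos : (0 : ℝ) < T := by positivity
  have hlogT : Real.log T ≤ 2 * l := by
    have h1 := Real.log_le_log hTpos hT2x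
    rw [Real.log_mul (by norm_num) hx0.ne'] at h1
    linarith [Real.log_two_lt_d9]
  have hlogT0 : 0 ≤ Real.log T := Real.log_natCast_nonneg T
  set J := 17 * (Nat.log 2 T + 1) with hJ
  have hJl : (J : ℝ) ≤ 85 * l := by
    have h1 := Real.natLog_le_logb T 2
    have h2 : Real.logb 2 T ≤ 2 * Real.log T := by
      rw [Real.logb, div_le_iff₀ (Real.log_pos (by norm_num))]
      nlinarith [Real.log_two_gt_d9]
    rw [hJ]
    push_cast at h1 ⊢
    linarith
  have hTJ : T ^ 17 < 2 ^ J := by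
    rw [hJ, mul_comm, pow_mul]
    exact Nat.pow_lt_pow_left (Nat.lt_pow_succ_log_self (by norm_num) T) (by norm_num)
  clear_value J
  have hex : ∃ b : ℕ, n ≤ T ^ 28 * b ^ 3 :=
    ⟨n, (Nat.le_self_pow (by norm_num) n).trans (Nat.le_mul_of_pos_left _ (by positivity))⟩
  obtain ⟨M, hMspec, hMmin⟩ : ∃ M : ℕ, n ≤ T ^ 28 * M ^ 3 ∧ ∀ b, n ≤ T ^ 28 * b ^ 3 → M ≤ b :=
    ⟨Nat.find hex, Nat.find_spec hex, fun b hb => Nat.find_min' hex hb⟩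
  have hM0 : M ≠ 0 := by
    rintro rfl
    rw [zero_pow three_ne_zero, mul_zero] at hMspec
    omega
  have hMpos : (0 : ℝ) < M := by positivity
  have hlogM : x / 4 ≤ Real.log M := by
    have h1 : Real.log n ≤ Real.log ((T : ℝ) ^ 28 * (M : ℝ) ^ 3) :=
      Real.log_le_log hn0 (by exact_mod_cast hMspec)
    rw [Real.log_mul (by positivity) (by positivity), Real.log_pow, Real.log_pow] at h1
    push_cast at h1
    linarith
  have hM2 : 2 ≤ M := by
    by_contra hcon
    have : M = 1 := by omega
    rw [this, Nat.cast_one, Real.log_one] at hlogM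
    linarith
  have hR : ∀ b : ℕ, n ≤ T ^ 28 * b ^ 3 → b ^ 3 ≤ T ^ 21 * n → b ∈ Ico M (2 ^ J * M) := by
    intro b hb1 hb2
    refine mem_Ico.2 ⟨hMmin b hb1, ?_⟩
    have h1 : b ^ 3 ≤ (T ^ 17 * M) ^ 3 :=
      calc b ^ 3 ≤ T ^ 21 * (T ^ 28 * M ^ 3) := hb2.trans (Nat.mul_le_mul_left _ hMspec)
        _ = T ^ 49 * M ^ 3 := by ring
        _ ≤ T ^ 51 * M ^ 3 :=
            Nat.mul_le_mul_right _ (Nat.pow_le_pow_right (Nat.pos_of_ne_zero hT0) (by norm_num))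
        _ = (T ^ 17 * M) ^ 3 := by ring
    have h2 : b ≤ T ^ 17 * M := (Nat.pow_le_pow_iff_left (by norm_num)).1 h1
    exact h2.trans_lt (Nat.mul_lt_mul_of_pos_right hTJ (Nat.pos_of_ne_zero hM0))
  -- The exponent `5/4` balances `x/Y` against `Y/x^(3/2)`: both become `x^(-1/4)`.
  have h := hmain n M J T (x ^ (5 / 4 : ℝ)) hT0 hM2 (by positivity) hR
  refine h.trans ?_
  have hq : 0 < x ^ (1 / 4 : ℝ) := by positivity
  have hY : x ^ (5 / 4 : ℝ) = x * x ^ (1 / 4 : ℝ) := by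
    rw [show (5 / 4 : ℝ) = 1 + 1 / 4 by norm_num, Real.rpow_add hx0, Real.rpow_one]
  have hqx : x ^ (1 / 4 : ℝ) ≤ x := by
    calc x ^ (1 / 4 : ℝ) ≤ x ^ (1 : ℝ) :=
          Real.rpow_le_rpow_of_exponent_le (by linarith) (by norm_num)
      _ = x := Real.rpow_one x
  have t1 : 2 * ((n : ℝ) / T) ≤ n * (2 / x ^ (1 / 4 : ℝ)) := by
    calc 2 * ((n : ℝ) / T) ≤ 2 * (n / x ^ (1 / 4 : ℝ)) := by
          gcongr
          exact hqx.trans hTx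
      _ = _ := by ring
  have t2 : n * (1 + x) / x ^ (5 / 4 : ℝ) ≤ n * (2 / x ^ (1 / 4 : ℝ)) := by
    rw [hY]
    calc n * (1 + x) / (x * x ^ (1 / 4 : ℝ)) ≤ n * (2 * x) / (x * x ^ (1 / 4 : ℝ)) := by
          gcongr
          linarith
      _ = _ := by field_simp
  have t3 : C * x ^ (5 / 4 : ℝ) * n * J ^ 2 * (1 + 6 * Real.log T) / √(Real.log M) ^ 3 ≤
      n * (C * (8 * 85 ^ 2 * 13) * l ^ 3 / x ^ (1 / 4 : ℝ)) := by
    have hs : √x / 2 ≤ √(Real.log M) := by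
      rw [show √x / 2 = √(x / 4) by
        rw [Real.sqrt_div hx0.le, show (4 : ℝ) = 2 ^ 2 by norm_num, Real.sqrt_sq (by norm_num)]]
      exact Real.sqrt_le_sqrt hlogM
    have hsx : 0 < √x := Real.sqrt_pos.2 hx0
    have hsq : x ^ (1 / 4 : ℝ) * x ^ (1 / 4 : ℝ) = √x := by
      rw [← Real.rpow_add hx0, Real.sqrt_eq_rpow]
      norm_num
    have hss : √x * √x = x := Real.mul_self_sqrt hx0.le
    calc C * x ^ (5 / 4 : ℝ) * n * J ^ 2 * (1 + 6 * Real.log T) / √(Real.log M) ^ 3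
        ≤ C * x ^ (5 / 4 : ℝ) * n * (85 * l) ^ 2 * (13 * l) / (√x / 2) ^ 3 := by
          gcongr
          linarith
      _ = _ := by
          rw [hY]
          generalize x ^ (1 / 4 : ℝ) = q at hq hsq
          have hx4 : x * q = q ^ 5 :=
            calc x * q = √x * √x * q := by rw [hss]
              _ = q ^ 5 := by rw [← hsq]; ring
          rw [hx4, ← hsq]
          field_simp
          norm_num
  calc _ ≤ n * (2 / x ^ (1 / 4 : ℝ)) + n * (2 / x ^ (1 / 4 : ℝ)) +
        n * (C * (8 * 85 ^ 2 * 13) * l ^ 3 / x ^ (1 / 4 : ℝ)) := by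
          exact add_le_add (add_le_add t1 t2) t3
    _ = _ := by ring

theorem exists_sub_maxSizeGamma_lt {κ : ℝ} (hκ : κ < 1 / 4) : ∃ n₀ : ℕ, ∀ n : ℕ, n₀ ≤ n →
    (n : ℝ) - maxSizeGamma 4 3 n < n / Real.log n ^ κ := by
  obtain ⟨C, hC, n₀, hmain⟩ := exists_sub_maxSizeGamma_le_log
  have hδ : 0 < 1 / 4 - κ := by linarith
  have ho : (fun y : ℝ => 4 + C * Real.log y ^ 3) =o[Filter.atTop]
      (fun y : ℝ => y ^ (1 / 4 - κ)) := by
    have h1 : (fun y : ℝ => Real.log y ^ 3) =o[Filter.atTop] (fun y : ℝ => y ^ (1 / 4 - κ)) := by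
      have := isLittleO_log_rpow_rpow_atTop 3 hδ
      simpa using this
    refine Asymptotics.IsLittleO.add ?_ (h1.const_mul_left C)
    exact Asymptotics.isLittleO_const_left.2
      (Or.inr (tendsto_norm_atTop_atTop.comp (tendsto_rpow_atTop hδ)))
  have hL : Filter.Tendsto (fun n : ℕ => Real.log n) Filter.atTop Filter.atTop :=
    Real.tendsto_log_atTop.comp tendsto_natCast_atTop_atTop
  obtain ⟨n₁, hn₁⟩ := Filter.eventually_atTop.1
    (hL.eventually (ho.def (show (0 : ℝ) < 1 / 2 by norm_num)))
  refine ⟨max (max n₀ n₁) 2, fun n hn => ?_⟩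
  have hn2 : 2 ≤ n := (le_max_right _ _).trans hn
  have hn0 : (0 : ℝ) < n := by positivity
  have hx0 : 0 < Real.log n := Real.log_pos (by exact_mod_cast (by omega : 1 < n))
  have h1 := hn₁ n (by omega)
  refine (hmain n (by omega)).trans_lt ?_
  have hp : 0 < Real.log n ^ (1 / 4 - κ) := by positivity
  rw [Real.norm_of_nonneg hp.le] at h1
  have h2 : 4 + C * Real.log (Real.log n) ^ 3 < Real.log n ^ (1 / 4 - κ) := by
    linarith [(Real.le_norm_self _).trans h1]
  rw [div_eq_mul_inv (n : ℝ)]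
  refine mul_lt_mul_of_pos_left ?_ hn0
  rw [div_lt_iff₀ (by positivity), ← Real.rpow_neg hx0.le, ← Real.rpow_add hx0]
  rwa [neg_add_eq_sub]

/-! ### Numerical comparison of exponents and conclusion -/

theorem one_sub_exp_one_mul_log_three_lt :
    1 - Real.exp 1 * Real.log 3 / (2 * √3) < 1 / 4 := by
  have he : 2.7 < Real.exp 1 := by linarith [Real.exp_one_gt_d9]
  have h3 : 1 < Real.log 3 := by
    rw [Real.lt_log_iff_exp_lt (by norm_num)]
    linarith [Real.exp_one_lt_d9]
  have hs : √3 < 1.75 := by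
    rw [Real.sqrt_lt' (by norm_num)]
    norm_num
  have hs0 : 0 < √3 := Real.sqrt_pos.2 (by norm_num)
  have : 3 / 4 < Real.exp 1 * Real.log 3 / (2 * √3) := by
    rw [lt_div_iff₀ (by positivity)]
    nlinarith
  linarith

theorem mainTheorem5 (ε : ℝ) (hε : 0 < ε) :
    ∃ n₀ : ℕ, ∀ n : ℕ, n₀ ≤ n →
      (n : ℝ) / (Real.log n) ^ (2 + ε) < (n : ℝ) - (maxSizeP 4 3 n : ℝ) ∧
      (n : ℝ) - (maxSizeP 4 3 n : ℝ) ≤ (n : ℝ) - (maxSizeGamma 4 3 n : ℝ) ∧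
      (n : ℝ) - (maxSizeGamma 4 3 n : ℝ) <
        (n : ℝ) / (Real.log n) ^
          (1 - Real.exp 1 * Real.log 3 / (2 * Real.sqrt 3) - ε) := by
  obtain ⟨n₁, h₁⟩ := exists_div_log_rpow_lt_sub_maxSizeP ε hε
  obtain ⟨n₂, h₂⟩ := exists_sub_maxSizeGamma_lt
    (κ := 1 - Real.exp 1 * Real.log 3 / (2 * Real.sqrt 3) - ε)
    (by linarith [one_sub_exp_one_mul_log_three_lt])
  refine ⟨max n₁ n₂, fun n hn => ⟨h₁ n (by omega), ?_, h₂ n (by omega)⟩⟩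
  have := maxSizeGamma_le_maxSizeP (k := 4) (d := 3) (by norm_num) n
  have h : (maxSizeGamma 4 3 n : ℝ) ≤ maxSizeP 4 3 n := by exact_mod_cast this
  linarith
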